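/- Let $a, d$ be positive integers with $ad \neq 1$. For $j=1,2$ let $\mathscr T^{(j)}$, with vertex set $V^{(j)} = V^{(j)}_1\times\cdots\times V^{(j)}_d$, be the directed Cartesian product of rooted directed trees $\mathscr T^{(j)}_1,\dots,\mathscr T^{(j)}_d$, each of which is locally finite, leafless (every vertex has a child) and has finite branching index (the depths of the vertices with at least two children are bounded). *Notation (index $j$ suppressed).* For $v\in V$ let $\mathsf d_v=(\mathsf d_{v_1},\dots,\mathsf d_{v_d})\in\mathbb N^d$ be the vector of depths of its coordinates, $|\mathsf d_v|=\sum_i\mathsf d_{v_i}$, and $\mathsf{root}$ the vertex all of whose coordinates are roots. $\mathsf{Chi}_i(v)$ is the set of vertices obtained from $v$ by replacing $v_i$ by one of its children; if $v_i$ is not the root, $\mathsf{par}_i(v)$ is obtained by replacing $v_i$ by its parent, and $\mathsf{sib}_i(v)=\mathsf{Chi}_i(\mathsf{par}_i(v))$. Let $S_1,\dots,S_d$ be the bounded operators on $\ell^2(V)$ given by $(S_if)(w)=\lambda_i(w)f(\mathsf{par}_i(w))$ if $w_i$ is not the root and $(S_if)(w)=0$ otherwise, where $$\lambda_i(w)=\sqrt{\frac{\mathfrak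 c_a(|\mathsf d_v|)}{\operatorname{card}\mathsf{Chi}_i(v)}}\sqrt{\frac{\mathsf d_{v_i}+1}{|\mathsf d_v|+d}},\qquad w\in\mathsf{Chi}_i(v),\qquad \mathfrak c_a(t)=\frac{t+d}{t+a},$$ and let $E=\bigcap_{i=1}^d\ker S_i^*$. For $F\subseteq\{1,\dots,d\}$ let $\Phi_F$ be the set of $v\in V$ such that $v_i$ is not the root exactly when $i\in F$; for $u\in\Phi_F$ let $\mathsf{sib}_F(u)$ be the set of $v \in V$ such that $v_i$ has the same parent as $u_i$ for $i\in F$ and $v_i=u_i$ for $i\notin F$. These sets partition $\Phi_F$; let $\Omega_F\subseteq\Phi_F$ contain exactly one element of each of them. For $u\in\Omega_F$ let $\mathcal L_{u,F}$ be the space of all $f\in\ell^2(V)$ that vanish outside $\mathsf{sib}_F(u)$ and satisfy $$\sum_{w\in\mathsf{sib}_i(v)}f(w)\lambda_i(w)=0\qquad\text{for all } i\in F \text{ and } v\in\mathsf{sib}_F(u).$$ Then $E$ is the orthogonal direct sum of the $\mathcal L_{u,F}$. Let $\mathscr H_{\mathfrak c_a}(\mathscr T)$ be the Hilbert space of $E$-valued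 functions on the open unit ball of $\mathbb C^d$ with reproducing kernel $$\kappa(z,w)=\sum_{F\subseteq\{1,\dots,d\}}\ \sum_{u\in\Omega_F}\Big(\sum_{\alpha\in\mathbb N^d}\frac{\mathsf d_u!}{(\mathsf d_u+\alpha)!}\prod_{l=0}^{|\alpha|-1}(|\mathsf d_u|+a+l)\,z^\alpha\overline w^{\alpha}\Big)P_{\mathcal L_{u,F}},$$ where $P_{\mathcal L_{u,F}}$ is the orthogonal projection of $E$ onto $\mathcal L_{u,F}$. The operators $\mathscr M_{z_1},\dots,\mathscr M_{z_d}$ of multiplication by the coordinate functions are bounded on $\mathscr H_{\mathfrak c_a}(\mathscr T)$, and $E$ embeds in it as the subspace of constant functions. **Proposition.** Let $U:\mathscr H_{\mathfrak c_a}(\mathscr T^{(1)})\to\mathscr H_{\mathfrak c_a}(\mathscr T^{(2)})$ be a Hilbert module isomorphism, that is, a unitary map with $U\mathscr M^{(1)}_{z_k}=\mathscr M^{(2)}_{z_k}U$ for $k=1,\dots,d$. Then, for every $\alpha\in\mathbb N^d$ and every $F\subseteq\{1,\dots,d\}$, $$U\Big(\bigoplus_{u\in\Omega^{(1)}_F,\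 \mathsf d_u=\alpha}\mathcal L^{(1)}_{u,F}\Big)=\bigoplus_{v\in\Omega^{(2)}_F,\ \mathsf d_v=\alpha}\mathcal L^{(2)}_{v,F},$$ where an empty direct sum is $\{0\}$ and the spaces $\mathcal L^{(j)}_{u,F}$ are regarded as spaces of constant functions. In particular, $U$ maps $e_{\mathsf{root}^{(1)}}$ to a unimodular scalar multiple of $e_{\mathsf{root}^{(2)}}$, where $e_{\mathsf{root}^{(j)}}$ is the indicator function of $\{\mathsf{root}^{(j)}\}$, regarded as a constant function. -/

import Mathlib

noncomputable section

open scoped ComplexConjugate ComplexOrder InnerProductSpace lp Nat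

/-- A rooted directed tree: every vertex except the root has exactly one parent, the root has no
parent, and every vertex is reached from the root along directed edges. -/
structure RootedDirectedTree (V : Type*) extends Digraph V where
  root : V
  not_adj_root : ∀ u, ¬ Adj u root
  existsUnique_parent : ∀ v, v ≠ root → ∃! u, Adj u v
  reachable : ∀ v, Relation.ReflTransGen Adj root v

namespace RootedDirectedTree

variable {V : Type*} (T : RootedDirectedTree V)

/-- The set of children of `v`. -/
def children (v : V) : Set V := {w | T.Adj v w}

open Classical in
/-- The parent of `v`; by convention the root is sent to itself. -/
def parent (v : V) : V :=
  if h : v = T.root then T.root else (T.existsUnique_parent v h).choose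

/-- The siblings of `v` (including `v`), i.e. the children of the parent of `v`;
the root has no siblings. -/
def siblings (v : V) : Set V := {w | v ≠ T.root ∧ T.Adj (T.parent v) w}

/-- The depth of `v`, i.e. the length of the path from the root to `v`. -/
def depth (v : V) : ℕ := sInf {n | T.parent^[n] v = T.root}

/-- A branching vertex is a vertex with at least two children. -/
def IsBranching (v : V) : Prop := 2 ≤ (T.children v).encard

/-- The branching index: `1 + sup` of the depths of the branching vertices, and `0` if there are
none; it is `⊤` if these depths are unbounded. -/
def branchingIndex : ℕ∞ := ⨆ (v : V) (_ : T.IsBranching v), ((T.depth v : ℕ∞) + 1)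

/-- Every vertex has finitely many children. -/
class LocallyFinite : Prop where
  finite_children : ∀ v, (T.children v).Finite

/-- Every vertex has a child. -/
class Leafless : Prop where
  nonempty_children : ∀ v, (T.children v).Nonempty

/-- The branching index is finite. A directed Cartesian product has finite joint branching index
if this holds for each of its factors. -/
class FiniteBranchingIndex : Prop where
  branchingIndex_ne_top : T.branchingIndex ≠ ⊤

lemma parent_root : T.parent T.root = T.root := by simp [parent]

lemma adj_parent {v : V} (h : v ≠ T.root) : T.Adj (T.parent v) v := by
  simp only [parent, h, dif_neg, not_false_eq_true]
  exact (T.existsUnique_parent v h).choose_spec.1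

lemma parent_eq {u v : V} (h : T.Adj u v) : T.parent v = u := by
  have hv : v ≠ T.root := by
    rintro rfl
    exact T.not_adj_root _ h
  exact (T.existsUnique_parent v hv).unique (T.adj_parent hv) h

lemma exists_iterate_parent (v : V) : ∃ n, T.parent^[n] v = T.root := by
  induction T.reachable v with
  | refl => exact ⟨0, rfl⟩
  | tail _ h ih =>
    obtain ⟨n, hn⟩ := ih
    exact ⟨n + 1, by rw [Function.iterate_succ_apply, T.parent_eq h, hn]⟩

lemma iterate_depth (v : V) : T.parent^[T.depth v] v = T.root :=
  Nat.sInf_mem (T.exists_iterate_parent v)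

lemma finite_siblings [T.LocallyFinite] (v : V) : (T.siblings v).Finite :=
  (LocallyFinite.finite_children (T := T) (T.parent v)).subset fun _ hw => hw.2

lemma finite_depth_le [T.LocallyFinite] (n : ℕ) : {v | T.depth v ≤ n}.Finite := by
  have key : ∀ n, {v | T.parent^[n] v = T.root}.Finite := by
    intro n
    induction n with
    | zero => simp
    | succ n ih =>
      refine ((ih.biUnion fun v _ => LocallyFinite.finite_children (T := T) v).union
        (Set.finite_singleton T.root)).subset ?_
      intro v hv
      by_cases h : v = T.root
      · exact Or.inr h
      · exact Or.inl (Set.mem_biUnion (x := T.parent v) hv (T.adj_parent h))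
  refine (key n).subset fun v hv => ?_
  obtain ⟨k, rfl⟩ := Nat.exists_eq_add_of_le hv
  change T.parent^[T.depth v + k] v = T.root
  rw [Nat.add_comm, Function.iterate_add_apply, T.iterate_depth]
  exact Function.iterate_fixed T.parent_root k

lemma finite_isBranching [T.LocallyFinite] [T.FiniteBranchingIndex] :
    {v | T.IsBranching v}.Finite := by
  obtain ⟨n, hn⟩ := ENat.ne_top_iff_exists.1
    (FiniteBranchingIndex.branchingIndex_ne_top (T := T))
  refine (T.finite_depth_le n).subset fun v hv => ?_
  have h : ((T.depth v : ℕ∞) + 1) ≤ T.branchingIndex :=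
    le_iSup₂ (f := fun (v : V) (_ : T.IsBranching v) => ((T.depth v : ℕ∞) + 1)) v hv
  rw [← hn] at h
  have h' : T.depth v + 1 ≤ n := by exact_mod_cast h
  exact (Nat.le_succ _).trans h'

end RootedDirectedTree

namespace TreeProduct

open RootedDirectedTree

variable {d : ℕ} {V : Fin d → Type*} (T : ∀ i, RootedDirectedTree (V i))

/-- The directed Cartesian product of `T 0, …, T (d - 1)`. -/
def digraph : Digraph (∀ i, V i) where
  Adj v w := ∃ k, (∀ j, j ≠ k → v j = w j) ∧ (T k).Adj (v k) (w k)

/-- The root of the directed Cartesian product. -/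
def root : ∀ i, V i := fun i => (T i).root

/-- The depth `𝖽_v ∈ ℕ^d` of a vertex. -/
def depth (v : ∀ i, V i) : Fin d → ℕ := fun i => (T i).depth (v i)

/-- `|𝖽_v|`. -/
def height (v : ∀ i, V i) : ℕ := ∑ i, depth T v i

/-- `Chi_j(v)`. -/
def childrenAt (j : Fin d) (v : ∀ i, V i) : Set (∀ i, V i) :=
  {w | (∀ i, i ≠ j → w i = v i) ∧ w j ∈ (T j).children (v j)}

/-- `par_j(v)`. -/
def parentAt (j : Fin d) (v : ∀ i, V i) : ∀ i, V i :=
  Function.update v j ((T j).parent (v j))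

/-- `sib_j(v)`. -/
def sibAt (j : Fin d) (v : ∀ i, V i) : Set (∀ i, V i) :=
  {w | (∀ i, i ≠ j → w i = v i) ∧ w j ∈ (T j).siblings (v j)}

/-- `Φ_F`: the vertices whose non-root coordinates are exactly those in `F`. -/
def Phi (F : Finset (Fin d)) : Set (∀ i, V i) := {v | ∀ i, v i ≠ (T i).root ↔ i ∈ F}

/-- `sib_F(u) = sib_{i₁} ⋯ sib_{iₖ}(u)` for `F = {i₁, …, iₖ}`. -/
def sib (F : Finset (Fin d)) (u : ∀ i, V i) : Set (∀ i, V i) :=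
  {w | (∀ i, i ∉ F → w i = u i) ∧ ∀ i ∈ F, w i ∈ (T i).siblings (u i)}

/-- `v_G`: the coordinates outside `G` are replaced by the roots. -/
def restrict (G : Finset (Fin d)) (v : ∀ i, V i) : ∀ i, V i :=
  fun i => if i ∈ G then v i else (T i).root

/-- The sequence `𝔠_a(t) = (t + d) / (t + a)`. -/
def cSeq (d a t : ℕ) : ℝ := ((t : ℝ) + d) / ((t : ℝ) + a)

/-- The weights of the Drury-Arveson-type multishift:
`λ_j(w) = √(𝔠_a(|𝖽_v|) / card Chi_j(v)) √((𝖽_{v_j} + 1) / (|𝖽_v| + d))` for `w ∈ Chi_j(v)`. -/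
def weight (a : ℕ) (j : Fin d) (w : ∀ i, V i) : ℝ :=
  √(cSeq d a (height T (parentAt T j w)) / (childrenAt T j (parentAt T j w)).ncard) *
    √((depth T (parentAt T j w) j + 1) / (height T (parentAt T j w) + d))

open Classical in
/-- The function `Λ^{(j)} f` underlying the `j`-th component of the multishift. -/
def shiftFun (a : ℕ) (j : Fin d) (f : (∀ i, V i) → ℂ) : (∀ i, V i) → ℂ :=
  fun w => if w j = (T j).root then 0 else (weight T a j w : ℂ) * f (parentAt T j w)

lemma finite_childrenAt [∀ i, (T i).LocallyFinite] (j : Fin d) (v : ∀ i, V i) :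
    (childrenAt T j v).Finite := by
  refine ((LocallyFinite.finite_children (T := T j) (v j)).image
    fun x => Function.update v j x).subset ?_
  rintro w ⟨h1, h2⟩
  refine ⟨w j, h2, ?_⟩
  ext i
  by_cases h : i = j
  · subst h; simp
  · simp [h, h1 i h]

lemma sum_weight_sq_le [∀ i, (T i).LocallyFinite] (a : ℕ) (j : Fin d) (v : ∀ i, V i)
    (s : Finset (∀ i, V i)) (hs : ∀ w ∈ s, w j ≠ (T j).root ∧ parentAt T j w = v) :
    ∑ w ∈ s, weight T a j w ^ 2 ≤ 2 := by
  have hsub : (s : Set (∀ i, V i)) ⊆ childrenAt T j v := by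
    intro w hw
    obtain ⟨h1, h2⟩ := hs w hw
    subst h2
    refine ⟨fun i hi => by simp [parentAt, hi], ?_⟩
    simpa [parentAt, children] using (T j).adj_parent h1
  have hcard : s.card ≤ (childrenAt T j v).ncard := by
    rw [← Set.ncard_coe_finset]
    exact Set.ncard_le_ncard hsub (finite_childrenAt T j v)
  have hd : 0 < d := j.pos
  have hle : depth T v j ≤ height T v :=
    Finset.single_le_sum (f := fun i => depth T v i) (fun _ _ => Nat.zero_le _) (Finset.mem_univ j)
  set m : ℕ := height T v with hm
  set n : ℕ := (childrenAt T j v).ncard with hn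
  have hW : ∀ w ∈ s, weight T a j w ^ 2 =
      (((m : ℝ) + d) / (m + a) / n) * ((depth T v j + 1) / (m + d)) := by
    intro w hw
    simp only [weight, (hs w hw).2, cSeq]
    rw [mul_pow, Real.sq_sqrt (by positivity), Real.sq_sqrt (by positivity)]
  rw [Finset.sum_congr rfl hW, Finset.sum_const, nsmul_eq_mul]
  have hle' : (depth T v j : ℝ) ≤ m := by exact_mod_cast hle
  have hcard' : (s.card : ℝ) ≤ n := by exact_mod_cast hcard
  have hd' : (0 : ℝ) < d := by exact_mod_cast hd
  have e : (s.card : ℝ) * (((m : ℝ) + d) / (m + a) / n * ((depth T v j + 1) / (m + d))) =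
      (s.card / n) * ((depth T v j + 1) / (m + a)) := by
    have : (m : ℝ) + d ≠ 0 := by positivity
    field_simp
  rw [e]
  have h1 : (s.card : ℝ) / n ≤ 1 := div_le_one_of_le₀ hcard' (by positivity)
  have h2 : ((depth T v j : ℝ) + 1) / (m + a) ≤ 2 := by
    rcases Nat.eq_zero_or_pos (m + a) with h0 | h0
    · have : (m : ℝ) + a = 0 := by exact_mod_cast h0
      simp [this]
    · have h0' : (1 : ℝ) ≤ (m : ℝ) + a := by exact_mod_cast h0
      rw [div_le_iff₀ (by linarith)]
      have : (0 : ℝ) ≤ a := by positivity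
      linarith
  calc _ ≤ 1 * (2 : ℝ) := mul_le_mul h1 h2 (by positivity) zero_le_one
    _ = 2 := one_mul _

lemma sum_shiftFun_le [∀ i, (T i).LocallyFinite] (a : ℕ) (j : Fin d)
    (f : ℓ²((∀ i, V i), ℂ)) (s : Finset (∀ i, V i)) :
    ∑ w ∈ s, ‖shiftFun T a j f w‖ ^ 2 ≤ 2 * ‖f‖ ^ 2 := by
  classical
  have hsum : ∀ t : Finset (∀ i, V i), ∑ v ∈ t, ‖f v‖ ^ 2 ≤ ‖f‖ ^ 2 := by
    intro t
    have := lp.sum_rpow_le_norm_rpow (p := 2) (by norm_num) f t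
    simpa using this
  set s' := s.filter fun w => w j ≠ (T j).root with hs'
  have h1 : ∑ w ∈ s, ‖shiftFun T a j f w‖ ^ 2 =
      ∑ w ∈ s', weight T a j w ^ 2 * ‖f (parentAt T j w)‖ ^ 2 := by
    rw [hs', Finset.sum_filter]
    refine Finset.sum_congr rfl fun w _ => ?_
    by_cases h : w j = (T j).root <;> simp [shiftFun, h, mul_pow]
  rw [h1, ← Finset.sum_fiberwise_of_maps_to (s := s') (t := s'.image (parentAt T j))
    (g := parentAt T j) fun w hw => Finset.mem_image_of_mem _ hw]
  calc _ ≤ ∑ v ∈ s'.image (parentAt T j), 2 * ‖f v‖ ^ 2 := by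
        refine Finset.sum_le_sum fun v _ => ?_
        have h2 : ∑ w ∈ s' with parentAt T j w = v,
              weight T a j w ^ 2 * ‖f (parentAt T j w)‖ ^ 2 =
            (∑ w ∈ s' with parentAt T j w = v, weight T a j w ^ 2) * ‖f v‖ ^ 2 := by
          rw [Finset.sum_mul]
          refine Finset.sum_congr rfl fun w hw => ?_
          rw [(Finset.mem_filter.1 hw).2]
        rw [h2]
        refine mul_le_mul_of_nonneg_right (sum_weight_sq_le T a j v _ fun w hw => ?_)
          (by positivity)
        simp only [hs', Finset.mem_filter] at hw
        exact ⟨hw.1.2, hw.2⟩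
    _ ≤ _ := by
        rw [← Finset.mul_sum]
        exact mul_le_mul_of_nonneg_left (hsum _) (by norm_num)

/-- The `j`-th component `S_j` of the Drury-Arveson-type multishift on `ℓ²(V)`. -/
def shift [∀ i, (T i).LocallyFinite] (a : ℕ) (j : Fin d) :
    ℓ²((∀ i, V i), ℂ) →L[ℂ] ℓ²((∀ i, V i), ℂ) :=
  LinearMap.mkContinuous
    { toFun := fun f => ⟨shiftFun T a j f, memℓp_gen' (C := 2 * ‖f‖ ^ 2) fun s => by
        simpa using sum_shiftFun_le T a j f s⟩
      map_add' := fun f g => by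
        ext w
        change shiftFun T a j _ w = shiftFun T a j f w + shiftFun T a j g w
        by_cases h : w j = (T j).root <;> simp [shiftFun, h, mul_add]
      map_smul' := fun c f => by
        ext w
        by_cases h : w j = (T j).root <;> simp [shiftFun, h, mul_left_comm] }
    2 fun f => by
      refine lp.norm_le_of_forall_sum_le (by norm_num) (by positivity) fun s => ?_
      have := sum_shiftFun_le T a j f s
      have h : (2 * ‖f‖) ^ 2 = 4 * ‖f‖ ^ 2 := by ring
      simp only [ENNReal.toReal_ofNat, Real.rpow_ofNat, h]
      refine le_trans this ?_
      nlinarith [sq_nonneg ‖f‖]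

lemma shift_apply [∀ i, (T i).LocallyFinite] (a : ℕ) (j : Fin d) (f : ℓ²((∀ i, V i), ℂ))
    (w : ∀ i, V i) : shift T a j f w = shiftFun T a j f w := rfl

/-- The joint kernel `E = ⋂_j ker S_j^*`. -/
def jointKernel [∀ i, (T i).LocallyFinite] (a : ℕ) : Submodule ℂ ℓ²((∀ i, V i), ℂ) :=
  ⨅ j, (ContinuousLinearMap.adjoint (shift T a j)).ker

instance [∀ i, (T i).LocallyFinite] (a : ℕ) : CompleteSpace (jointKernel T a) := by
  refine IsClosed.completeSpace_coe (hs := ?_)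
  simp only [jointKernel, Submodule.coe_iInf]
  exact isClosed_iInter fun j => ContinuousLinearMap.isClosed_ker _

lemma finite_sibAt [∀ i, (T i).LocallyFinite] (j : Fin d) (v : ∀ i, V i) :
    (sibAt T j v).Finite := by
  refine (((T j).finite_siblings (v j)).image fun x => Function.update v j x).subset ?_
  rintro w ⟨h1, h2⟩
  refine ⟨w j, h2, ?_⟩
  ext i
  by_cases h : i = j
  · subst h; simp
  · simp [h, h1 i h]

lemma finite_sib [∀ i, (T i).LocallyFinite] (F : Finset (Fin d)) (u : ∀ i, V i) :
    (sib T F u).Finite := by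
  classical
  refine (Set.Finite.pi' (t := fun i => (T i).siblings (u i) ∪ {u i}) fun i =>
    ((T i).finite_siblings (u i)).union (Set.finite_singleton _)).subset ?_
  rintro w ⟨h1, h2⟩ i
  by_cases h : i ∈ F
  · exact Or.inl (h2 i h)
  · exact Or.inr (h1 i h)

/-- `𝓛_{u,F} ⊆ ℓ²(sib_F(u))`: the solution space of the system
`∑_{w ∈ sib_j(v_G | u_j)} f(w) λ_j(w) = 0`, where `j ∈ F`, `G = F \ {j}` and `v ∈ sib_F(u)`.
Here `v_G | u_j` is `v_G` with the `j`-th coordinate replaced by `u_j`. -/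
def solutionSpace [∀ i, (T i).LocallyFinite] (a : ℕ) (u : ∀ i, V i) (F : Finset (Fin d)) :
    Submodule ℂ ℓ²((∀ i, V i), ℂ) where
  carrier := {f | (∀ w, w ∉ sib T F u → f w = 0) ∧ ∀ j ∈ F, ∀ v ∈ sib T F u,
    ∑ᶠ w ∈ sibAt T j (Function.update (restrict T (F \ {j}) v) j (u j)),
      f w * (weight T a j w : ℂ) = 0}
  zero_mem' := by simp
  add_mem' := by
    rintro f g ⟨hf1, hf2⟩ ⟨hg1, hg2⟩
    refine ⟨fun w hw => by simp [hf1 w hw, hg1 w hw], fun j hj v hv => ?_⟩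
    have h := finsum_mem_add_distrib (f := fun w => f w * (weight T a j w : ℂ))
      (g := fun w => g w * (weight T a j w : ℂ))
      (finite_sibAt T j (Function.update (restrict T (F \ {j}) v) j (u j)))
    rw [hf2 j hj v hv, hg2 j hj v hv, add_zero] at h
    simpa [add_mul] using h
  smul_mem' := by
    rintro c f ⟨hf1, hf2⟩
    refine ⟨fun w hw => by simp [hf1 w hw], fun j hj v hv => ?_⟩
    have h := mul_finsum_mem
      (s := sibAt T j (Function.update (restrict T (F \ {j}) v) j (u j)))
      (fun w => f w * (weight T a j w : ℂ)) c
    rw [hf2 j hj v hv, mul_zero] at h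
    simpa [mul_assoc] using h.symm

instance [∀ i, (T i).LocallyFinite] (a : ℕ) (u : ∀ i, V i) (F : Finset (Fin d)) :
    FiniteDimensional ℂ (solutionSpace T a u F) := by
  have := (finite_sib T F u).to_subtype
  let q : solutionSpace T a u F →ₗ[ℂ] (sib T F u → ℂ) :=
    { toFun := fun f w => f.1 w
      map_add' := fun f g => by ext; simp
      map_smul' := fun c f => by ext; simp }
  refine FiniteDimensional.of_injective q fun f g h => ?_
  ext w
  by_cases hw : w ∈ sib T F u
  · exact congrFun h ⟨w, hw⟩
  · rw [f.2.1 w hw, g.2.1 w hw]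

/-- `𝓛_{u,F}` as a subspace of `E`; for `u ∈ Φ_F` one has `𝓛_{u,F} ⊆ E`, see
`mem_solutionSpace_iff`. -/
def solutionSpaceIn [∀ i, (T i).LocallyFinite] (a : ℕ) (u : ∀ i, V i) (F : Finset (Fin d)) :
    Submodule ℂ (jointKernel T a) :=
  (solutionSpace T a u F).submoduleOf (jointKernel T a)

instance [∀ i, (T i).LocallyFinite] (a : ℕ) (u : ∀ i, V i) (F : Finset (Fin d)) :
    FiniteDimensional ℂ (solutionSpaceIn T a u F) := by
  let q : solutionSpaceIn T a u F →ₗ[ℂ] solutionSpace T a u F :=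
    { toFun := fun f => ⟨f.1.1, f.2⟩
      map_add' := fun f g => rfl
      map_smul' := fun c f => rfl }
  refine FiniteDimensional.of_injective q fun f g h => Subtype.ext (Subtype.ext ?_)
  exact congrArg (fun x : solutionSpace T a u F => x.1) h

/-- A choice of indexing sets `Ω_F`, `F ⊆ {1, …, d}`: each `Ω_F` consists of exactly one element
from each of the equivalence classes `sib_F(u)`, `u ∈ Φ_F`. -/
structure IndexingSystem where
  Ω : Finset (Fin d) → Set (∀ i, V i)
  subset_Phi : ∀ F, Ω F ⊆ Phi T F
  existsUnique_mem : ∀ F, ∀ v ∈ Phi T F, ∃! u, u ∈ Ω F ∧ v ∈ sib T F u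

/-- The coefficient `𝖽_u! / (𝖽_u + α)! ∏_{j < |α|} (|𝖽_u| + a + j)`. -/
def kernelCoeff (a : ℕ) (u : ∀ i, V i) (α : Fin d → ℕ) : ℝ :=
  ((∏ i, (depth T u i)! : ℕ) : ℝ) / ((∏ i, (depth T u i + α i)! : ℕ) : ℝ) *
    ∏ j ∈ Finset.range (∑ i, α i), ((height T u : ℝ) + a + j)

/-- The open unit ball of `ℂ^d`. -/
abbrev UnitBall (d : ℕ) : Type := Metric.ball (0 : EuclideanSpace ℂ (Fin d)) 1

/-- The `i`-th coordinate of a point of the unit ball. -/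
abbrev UnitBall.coord {d : ℕ} (i : Fin d) (z : UnitBall d) : ℂ := z.1 i

/-- The monomial `z^α`. -/
def monomial (α : Fin d → ℕ) (z : UnitBall d) : ℂ := ∏ i, UnitBall.coord i z ^ α i

/-- The scalar kernel
`∑_α 𝖽_u! / (𝖽_u + α)! ∏_{j < |α|} (|𝖽_u| + a + j) z^α conj(w)^α`. -/
def scalarKernel (a : ℕ) (u : ∀ i, V i) (z w : UnitBall d) : ℂ :=
  ∑' α : Fin d → ℕ, (kernelCoeff T a u α : ℂ) * (monomial α z * conj (monomial α w))

variable {T} in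
/-- The `B(E)`-valued kernel of the Drury-Arveson-type space:
`κ(z, w) = ∑_F ∑_{u ∈ Ω_F} κ_u(z, w) P_{𝓛_{u,F}}`, with `κ_u` the scalar kernel of `u` and
`P_{𝓛_{u,F}}` the orthogonal projection of `E` onto `𝓛_{u,F}`. -/
def kernel [∀ i, (T i).LocallyFinite] (a : ℕ) (I : IndexingSystem T) :
    Matrix (UnitBall d) (UnitBall d) (jointKernel T a →L[ℂ] jointKernel T a) :=
  .of fun z w => ∑ F : Finset (Fin d), ∑' u : I.Ω F,
    scalarKernel T a u z w • (solutionSpaceIn T a u F).starProjection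

/-! ### Positivity of the kernel -/

lemma kernelCoeff_nonneg (a : ℕ) (u : ∀ i, V i) (α : Fin d → ℕ) : 0 ≤ kernelCoeff T a u α := by
  unfold kernelCoeff
  positivity

lemma kernelCoeff_le (a : ℕ) (u : ∀ i, V i) (α : Fin d → ℕ) :
    kernelCoeff T a u α ≤ ((∑ i, α i + (height T u + a)).choose (height T u + a) : ℝ) *
      Nat.multinomial Finset.univ α := by
  set n := ∑ i, α i with hn
  set m := height T u + a with hm
  have h1 : ∏ j ∈ Finset.range n, ((height T u : ℝ) + a + j) ≤ ((m + 1).ascFactorial n : ℝ) := by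
    rw [Nat.ascFactorial_eq_prod_range]
    push_cast
    refine Finset.prod_le_prod (fun j _ => by positivity) fun j _ => ?_
    rw [hm]; push_cast; linarith
  have h2 : ((∏ i, (depth T u i)! : ℕ) : ℝ) / ((∏ i, (depth T u i + α i)! : ℕ) : ℝ) ≤
      1 / ((∏ i, (α i)! : ℕ) : ℝ) := by
    rw [div_le_div_iff₀ (by positivity) (by positivity), one_mul]
    rw [← Nat.cast_mul, ← Finset.prod_mul_distrib]
    exact_mod_cast Finset.prod_le_prod' fun i _ =>
      Nat.le_of_dvd (Nat.factorial_pos _) (Nat.factorial_mul_factorial_dvd_factorial_add _ _)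
  have h3 : ((m + 1).ascFactorial n : ℝ) = n ! * (n + m).choose m := by
    rw [Nat.ascFactorial_eq_factorial_mul_choose, Nat.add_comm m n, Nat.choose_symm_add]
    push_cast; rfl
  have h4 : (Nat.multinomial Finset.univ α : ℝ) = n ! / ((∏ i, (α i)! : ℕ) : ℝ) := by
    rw [eq_div_iff (by positivity), mul_comm]
    exact_mod_cast Nat.multinomial_spec Finset.univ α
  calc kernelCoeff T a u α
      ≤ 1 / ((∏ i, (α i)! : ℕ) : ℝ) * (n ! * (n + m).choose m) := by
        rw [← h3]
        exact mul_le_mul h2 h1 (Finset.prod_nonneg fun _ _ => by positivity) (by positivity)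
    _ = _ := by rw [h4]; ring

lemma summable_kernelCoeff (a : ℕ) (u : ∀ i, V i) (x : Fin d → ℝ) (hx : ∀ i, 0 ≤ x i)
    (hx1 : ∑ i, x i < 1) :
    Summable fun α : Fin d → ℕ => kernelCoeff T a u α * ∏ i, x i ^ α i := by
  classical
  set m := height T u + a with hm
  set r := ∑ i, x i with hr
  have hr0 : 0 ≤ r := Finset.sum_nonneg fun i _ => hx i
  have hs : Summable fun n : ℕ => ((n + m).choose m : ℝ) * r ^ n :=
    summable_choose_mul_geometric_of_norm_lt_one m (by rwa [Real.norm_of_nonneg hr0])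
  have hp : ∀ α : Fin d → ℕ, 0 ≤ ∏ i, x i ^ α i := fun α =>
    Finset.prod_nonneg fun i _ => pow_nonneg (hx i) _
  refine summable_of_sum_le (c := ∑' n : ℕ, ((n + m).choose m : ℝ) * r ^ n)
    (fun α => mul_nonneg (kernelCoeff_nonneg T a u α) (hp α)) fun s => ?_
  set t := s.image fun α => ∑ i, α i with ht
  rw [← Finset.sum_fiberwise_of_maps_to (s := s) (t := t) (g := fun α => ∑ i, α i)
    fun α hα => Finset.mem_image_of_mem _ hα]
  refine le_trans (Finset.sum_le_sum fun n _ => ?_)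
    (hs.sum_le_tsum t fun n _ => by positivity)
  calc ∑ α ∈ s with ∑ i, α i = n, kernelCoeff T a u α * ∏ i, x i ^ α i
      ≤ ∑ α ∈ s with ∑ i, α i = n,
          ((n + m).choose m : ℝ) * (Nat.multinomial Finset.univ α * ∏ i, x i ^ α i) := by
        refine Finset.sum_le_sum fun α hα => ?_
        rw [← mul_assoc]
        refine mul_le_mul_of_nonneg_right ?_ (hp α)
        have := kernelCoeff_le T a u α
        rwa [(Finset.mem_filter.1 hα).2] at this
    _ ≤ ∑ α ∈ Finset.piAntidiag Finset.univ n,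
          ((n + m).choose m : ℝ) * (Nat.multinomial Finset.univ α * ∏ i, x i ^ α i) := by
        refine Finset.sum_le_sum_of_subset_of_nonneg (fun α hα => ?_) fun α _ _ => ?_
        · simpa [Finset.mem_piAntidiag] using (Finset.mem_filter.1 hα).2
        · have := hp α
          positivity
    _ = _ := by
        rw [← Finset.mul_sum, hr, Finset.sum_pow_eq_sum_piAntidiag]

lemma sum_norm_coord_mul_lt_one (z w : UnitBall d) :
    ∑ i, ‖UnitBall.coord i z‖ * ‖UnitBall.coord i w‖ < 1 := by
  have hz : ‖z.1‖ < 1 := mem_ball_zero_iff.1 z.2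
  have hw : ‖w.1‖ < 1 := mem_ball_zero_iff.1 w.2
  have h := Real.sum_mul_le_sqrt_mul_sqrt Finset.univ
    (fun i => ‖UnitBall.coord i z‖) fun i => ‖UnitBall.coord i w‖
  rw [← EuclideanSpace.norm_eq, ← EuclideanSpace.norm_eq] at h
  exact h.trans_lt (mul_lt_one_of_nonneg_of_lt_one_left (norm_nonneg _) hz hw.le)

lemma summable_scalarKernel (a : ℕ) (u : ∀ i, V i) (b : (Fin d → ℕ) → ℝ) (hb : ∀ α, 0 ≤ b α)
    (hbc : ∀ α, b α ≤ kernelCoeff T a u α) (z w : UnitBall d) :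
    Summable fun α => (b α : ℂ) * (monomial α z * conj (monomial α w)) := by
  refine Summable.of_norm_bounded (g := fun α => kernelCoeff T a u α *
    ∏ i, (‖UnitBall.coord i z‖ * ‖UnitBall.coord i w‖) ^ α i)
    (summable_kernelCoeff T a u _ (fun i => by positivity) (sum_norm_coord_mul_lt_one z w))
    fun α => ?_
  have : ‖monomial α z * conj (monomial α w)‖ =
      ∏ i, (‖UnitBall.coord i z‖ * ‖UnitBall.coord i w‖) ^ α i := by
    simp [monomial, norm_prod, mul_pow, Finset.prod_mul_distrib]
  rw [norm_mul, this, Complex.norm_real, Real.norm_of_nonneg (hb α)]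
  exact mul_le_mul_of_nonneg_right (hbc α) (Finset.prod_nonneg fun i _ => by positivity)

lemma weight_pos [∀ i, (T i).LocallyFinite] (a : ℕ) [NeZero a] (j : Fin d) (w : ∀ i, V i)
    (hw : w j ≠ (T j).root) : 0 < weight T a j w := by
  have ha : (0 : ℝ) < a := by exact_mod_cast Nat.pos_of_neZero a
  have hd : (0 : ℝ) < d := by exact_mod_cast j.pos
  have hmem : w ∈ childrenAt T j (parentAt T j w) := by
    refine ⟨fun i hi => by simp [parentAt, hi], ?_⟩
    simpa [parentAt, children] using (T j).adj_parent hw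
  have hn : 0 < (childrenAt T j (parentAt T j w)).ncard :=
    (Set.ncard_pos (finite_childrenAt T j _)).2 ⟨w, hmem⟩
  have hn' : (0 : ℝ) < (childrenAt T j (parentAt T j w)).ncard := by exact_mod_cast hn
  unfold weight cSeq
  positivity

lemma isBranching_of_solutionSpace_ne_bot [∀ i, (T i).LocallyFinite] (a : ℕ) [NeZero a]
    (u : ∀ i, V i) (F : Finset (Fin d)) (hu : u ∈ Phi T F) (h : solutionSpace T a u F ≠ ⊥)
    (j : Fin d) (hj : j ∈ F) : (T j).IsBranching ((T j).parent (u j)) := by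
  by_contra hb
  refine h ((Submodule.eq_bot_iff _).2 fun f hf => ?_)
  ext v
  change f v = 0
  by_cases hv : v ∈ sib T F u
  swap
  · exact hf.1 v hv
  have hu0 : u j ≠ (T j).root := (hu j).2 hj
  have hle : ((T j).children ((T j).parent (u j))).encard ≤ 1 := by
    have h1 := not_le.1 hb
    exact Order.le_of_lt_add_one (by simpa [one_add_one_eq_two] using h1)
  have huniq : ∀ x ∈ (T j).siblings (u j), x = u j := fun x hx =>
    Set.encard_le_one_iff.1 hle _ _ hx.2 ((T j).adj_parent hu0)
  have hset : sibAt T j (Function.update (restrict T (F \ {j}) v) j (u j)) = {v} := by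
    have hvj : v j = u j := huniq _ (hv.2 j hj)
    have hupd : Function.update (restrict T (F \ {j}) v) j (u j) = v := by
      ext i
      by_cases hi : i = j
      · subst hi; simp [hvj]
      · by_cases hiF : i ∈ F
        · simp [hi, restrict, hiF]
        · have : v i = (T i).root := by
            rw [hv.1 i hiF]
            by_contra hne
            exact hiF ((hu i).1 hne)
          simp [hi, restrict, hiF, this]
    rw [hupd]
    ext w
    simp only [sibAt, Set.mem_ofPred_eq, Set.mem_singleton_iff]
    constructor
    · rintro ⟨h1, h2⟩
      ext i
      by_cases hi : i = j
      · subst hi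
        rw [hvj] at h2 ⊢
        exact huniq _ h2
      · exact h1 i hi
    · rintro rfl
      refine ⟨fun _ _ => rfl, ?_⟩
      rw [hvj]
      exact ⟨hu0, (T j).adj_parent hu0⟩
  have heq := hf.2 j hj v hv
  rw [hset, finsum_mem_singleton] at heq
  have hvr : v j ≠ (T j).root := by rw [huniq _ (hv.2 j hj)]; exact hu0
  rcases mul_eq_zero.1 heq with h0 | h0
  · exact h0
  · exact absurd (by exact_mod_cast h0) (weight_pos T a j v hvr).ne'

/-! ### Description of `E` and of the projections onto `𝓛_{u,F}` -/

lemma mem_childrenAt_iff (j : Fin d) (v w : ∀ i, V i) :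
    w ∈ childrenAt T j v ↔ w j ≠ (T j).root ∧ parentAt T j w = v := by
  constructor
  · rintro ⟨h1, h2⟩
    refine ⟨fun h => (T j).not_adj_root (v j) (h ▸ h2), ?_⟩
    ext i
    by_cases h : i = j
    · subst h; simpa [parentAt] using (T i).parent_eq h2
    · simp [parentAt, h, h1 i h]
  · rintro ⟨h1, rfl⟩
    refine ⟨fun i hi => by simp [parentAt, hi], ?_⟩
    simpa [parentAt, children] using (T j).adj_parent h1

open Classical in
lemma adjoint_shift_apply [∀ i, (T i).LocallyFinite] (a : ℕ) (j : Fin d)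
    (f : ℓ²((∀ i, V i), ℂ)) (v : ∀ i, V i) :
    ContinuousLinearMap.adjoint (shift T a j) f v =
      ∑ᶠ w ∈ childrenAt T j v, f w * (weight T a j w : ℂ) := by
  have h := lp.inner_single_left (𝕜 := ℂ) v (1 : ℂ) (ContinuousLinearMap.adjoint (shift T a j) f)
  have h' : ContinuousLinearMap.adjoint (shift T a j) f v =
      ⟪lp.single 2 v (1 : ℂ), ContinuousLinearMap.adjoint (shift T a j) f⟫_ℂ := by
    rw [h]; simp
  rw [h', ContinuousLinearMap.adjoint_inner_right, lp.inner_eq_tsum,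
    finsum_mem_eq_finite_toFinset_sum _ (finite_childrenAt T j v), tsum_eq_sum]
  rotate_right
  · exact (finite_childrenAt T j v).toFinset
  · refine Finset.sum_congr rfl fun w hw => ?_
    have hw' := (mem_childrenAt_iff T j v w).1 (by simpa using hw)
    simp [shift_apply, shiftFun, hw'.1, hw'.2]
  · intro w hw
    have hw' : ¬ _ := fun h => hw ((Set.Finite.mem_toFinset _).2 ((mem_childrenAt_iff T j v w).2 h))
    by_cases h0 : w j = (T j).root
    · simp [shift_apply, shiftFun, h0]
    · have : parentAt T j w ≠ v := fun h => hw' ⟨h0, h⟩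
      simp [shift_apply, shiftFun, h0, this]

lemma mem_jointKernel_iff [∀ i, (T i).LocallyFinite] (a : ℕ) (f : ℓ²((∀ i, V i), ℂ)) :
    f ∈ jointKernel T a ↔ ∀ j v, ∑ᶠ w ∈ childrenAt T j v, f w * (weight T a j w : ℂ) = 0 := by
  simp only [jointKernel, Submodule.mem_iInf, ← adjoint_shift_apply]
  refine forall_congr' fun j => ?_
  constructor
  · intro h v
    have h : ContinuousLinearMap.adjoint (shift T a j) f = 0 := h
    rw [h]; rfl
  · intro h
    change ContinuousLinearMap.adjoint (shift T a j) f = 0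
    ext v; exact h v

lemma sibAt_eq (j : Fin d) (F : Finset (Fin d)) (u v : ∀ i, V i) (hu : u ∈ Phi T F) (hj : j ∈ F)
    (hv : v ∈ sib T F u) :
    sibAt T j (Function.update (restrict T (F \ {j}) v) j (u j)) =
      childrenAt T j (parentAt T j v) := by
  have hp : (T j).parent (v j) = (T j).parent (u j) := (T j).parent_eq (hv.2 j hj).2
  have hr : ∀ i, i ≠ j → restrict T (F \ {j}) v i = v i := by
    intro i hi
    by_cases hiF : i ∈ F
    · simp [restrict, hi, hiF]
    · have : v i = (T i).root := by
        rw [hv.1 i hiF]; by_contra hne; exact hiF ((hu i).1 hne)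
      simp [restrict, hiF, this]
  ext w
  constructor
  · rintro ⟨h1, h2⟩
    refine ⟨fun i hi => by simpa [parentAt, hi, hr i hi] using h1 i hi, ?_⟩
    have := h2.2
    simp only [Function.update_self] at this
    simpa [parentAt, children, hp] using this
  · rintro ⟨h1, h2⟩
    refine ⟨fun i hi => by simpa [parentAt, hi, hr i hi] using h1 i hi, ?_⟩
    simp only [Function.update_self]
    refine ⟨(hu j).2 hj, ?_⟩
    simpa [parentAt, children, hp] using h2

lemma childrenAt_subset (j : Fin d) (F : Finset (Fin d)) (u v w : ∀ i, V i) (hu : u ∈ Phi T F)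
    (hv : v ∈ sib T F u) (hvj : v j ≠ (T j).root) (hw : w ∈ childrenAt T j (parentAt T j v)) :
    j ∈ F ∧ w ∈ sib T F u := by
  have hj : j ∈ F := by
    by_contra hj
    rw [hv.1 j hj] at hvj
    exact hj ((hu j).1 hvj)
  refine ⟨hj, ?_⟩
  have hp : (T j).parent (v j) = (T j).parent (u j) := (T j).parent_eq (hv.2 j hj).2
  refine ⟨fun i hi => ?_, fun i hi => ?_⟩
  · have hij : i ≠ j := fun h => hi (h ▸ hj)
    rw [hw.1 i hij]; simpa [parentAt, hij] using hv.1 i hi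
  · by_cases hij : i = j
    · subst hij
      refine ⟨(hu i).2 hi, ?_⟩
      simpa [parentAt, children, hp] using hw.2
    · rw [hw.1 i hij]; simpa [parentAt, hij] using hv.2 i hi

lemma mem_solutionSpace_iff [∀ i, (T i).LocallyFinite] (a : ℕ) (u : ∀ i, V i)
    (F : Finset (Fin d)) (hu : u ∈ Phi T F) (f : ℓ²((∀ i, V i), ℂ)) :
    f ∈ solutionSpace T a u F ↔ (∀ w, w ∉ sib T F u → f w = 0) ∧ f ∈ jointKernel T a := by
  rw [mem_jointKernel_iff]
  constructor
  · rintro ⟨h1, h2⟩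
    refine ⟨h1, fun j v => ?_⟩
    by_cases h : ∃ w ∈ childrenAt T j v, w ∈ sib T F u
    · obtain ⟨w, hw, hwu⟩ := h
      obtain ⟨hw1, rfl⟩ := (mem_childrenAt_iff T j v w).1 hw
      obtain ⟨hj, -⟩ := childrenAt_subset T j F u w w hu hwu hw1 hw
      rw [← sibAt_eq T j F u w hu hj hwu]
      exact h2 j hj w hwu
    · push Not at h
      refine finsum_mem_eq_zero_of_forall_eq_zero fun w hw => ?_
      rw [h1 w (h w hw), zero_mul]
  · rintro ⟨h1, h2⟩
    refine ⟨h1, fun j hj v hv => ?_⟩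
    rw [sibAt_eq T j F u v hu hj hv]
    exact h2 j _

open Classical in
lemma exists_restrict [∀ i, (T i).LocallyFinite] (a : ℕ) (u : ∀ i, V i)
    (F : Finset (Fin d)) (hu : u ∈ Phi T F) (f : ℓ²((∀ i, V i), ℂ)) (hf : f ∈ jointKernel T a) :
    ∃ g ∈ solutionSpace T a u F, ∀ w, g w = if w ∈ sib T F u then f w else 0 := by
  let g : ℓ²((∀ i, V i), ℂ) := ⟨fun w => if w ∈ sib T F u then f w else 0,
    (lp.memℓp f).mono' fun w => by split_ifs <;> simp⟩
  have hg : ∀ w, g w = if w ∈ sib T F u then f w else 0 := fun w => rfl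
  refine ⟨g, (mem_solutionSpace_iff T a u F hu g).2 ⟨fun w hw => by rw [hg, if_neg hw], ?_⟩, hg⟩
  rw [mem_jointKernel_iff] at hf ⊢
  intro j v
  by_cases h : ∃ w ∈ childrenAt T j v, w ∈ sib T F u
  · obtain ⟨w, hw, hwu⟩ := h
    obtain ⟨hw1, rfl⟩ := (mem_childrenAt_iff T j v w).1 hw
    rw [← hf j (parentAt T j w)]
    refine finsum_mem_congr rfl fun w' hw' => ?_
    rw [hg, if_pos (childrenAt_subset T j F u w w' hu hwu hw1 hw').2]
  · push Not at h
    refine finsum_mem_eq_zero_of_forall_eq_zero fun w hw => ?_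
    rw [hg, if_neg (h w hw), zero_mul]

open Classical in
lemma starProjection_apply [∀ i, (T i).LocallyFinite] (a : ℕ) (u : ∀ i, V i)
    (F : Finset (Fin d)) (hu : u ∈ Phi T F) (f : jointKernel T a) (w : ∀ i, V i) :
    ((solutionSpaceIn T a u F).starProjection f).1 w = if w ∈ sib T F u then f.1 w else 0 := by
  obtain ⟨g, hg1, hg2⟩ := exists_restrict T a u F hu f.1 f.2
  have hgE : g ∈ jointKernel T a := ((mem_solutionSpace_iff T a u F hu g).1 hg1).2
  have : (solutionSpaceIn T a u F).starProjection f = ⟨g, hgE⟩ := by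
    refine Submodule.eq_starProjection_of_mem_of_inner_eq_zero (by exact hg1) fun x hx => ?_
    have hx' : x.1 ∈ solutionSpace T a u F := hx
    rw [Submodule.coe_inner, lp.inner_eq_tsum]
    refine (tsum_congr fun v => ?_).trans tsum_zero
    have e : (f - ⟨g, hgE⟩ : jointKernel T a).1 v = f.1 v - g v := rfl
    rw [e, hg2]
    by_cases hv : v ∈ sib T F u
    · simp [hv]
    · rw [hx'.1 v hv]; simp
  rw [this]; exact hg2 w

lemma scalarKernel_zero (a : ℕ) (u : ∀ i, V i) (z w : UnitBall d) (hw : w.1 = 0) :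
    scalarKernel T a u z w = 1 := by
  unfold scalarKernel
  rw [tsum_eq_single 0]
  · have : ((∏ i, (depth T u i).factorial : ℕ) : ℝ) ≠ 0 := by positivity
    simp [kernelCoeff, monomial]
    have h2 : (∏ i, ((depth T u i).factorial : ℂ)) ≠ 0 :=
      Finset.prod_ne_zero_iff.2 fun i _ => by exact_mod_cast Nat.factorial_ne_zero _
    exact h2
  · intro α hα
    obtain ⟨i, hi⟩ := Function.ne_iff.1 hα
    have : monomial α w = 0 := Finset.prod_eq_zero (Finset.mem_univ i) (by
      simp only [UnitBall.coord, hw]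
      simpa using hi)
    simp [this]

variable {T}

lemma finite_solutionSpaceIn_ne_bot [∀ i, (T i).LocallyFinite] [∀ i, (T i).FiniteBranchingIndex]
    (a : ℕ) [NeZero a] (I : IndexingSystem T) (F : Finset (Fin d)) :
    {u : I.Ω F | solutionSpaceIn T a u F ≠ ⊥}.Finite := by
  have hfin : {u : ∀ i, V i | ∀ i, u i ∈
      {(T i).root} ∪ ⋃ p ∈ {p | (T i).IsBranching p}, (T i).children p}.Finite :=
    Set.Finite.pi' fun i => (Set.finite_singleton _).union
      ((T i).finite_isBranching.biUnion fun p _ => LocallyFinite.finite_children p)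
  refine Set.Finite.of_finite_image (f := Subtype.val) (hfin.subset ?_)
    Subtype.val_injective.injOn
  rintro _ ⟨u, hu, rfl⟩ i
  have hΦ := I.subset_Phi F u.2
  by_cases hi : i ∈ F
  · have hne : solutionSpace T a u F ≠ ⊥ := by
      intro h0
      refine hu ((Submodule.eq_bot_iff _).2 fun f hf => ?_)
      have : f.1 ∈ solutionSpace T a u F := hf
      rw [h0, Submodule.mem_bot] at this
      exact Subtype.ext this
    exact Or.inr (Set.mem_biUnion (x := (T i).parent (u.1 i))
      (isBranching_of_solutionSpace_ne_bot T a u F hΦ hne i hi) ((T i).adj_parent ((hΦ i).2 hi)))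
  · refine Or.inl ?_
    by_contra h
    exact hi ((hΦ i).1 h)

lemma posSemidef_diagonal {E : Type*} [NormedAddCommGroup E] [InnerProductSpace ℂ E]
    [CompleteSpace E] (S : Submodule ℂ E) [S.HasOrthogonalProjection]
    (b : (Fin d → ℕ) → ℝ) (hb : ∀ α, 0 ≤ b α)
    (hs : ∀ z w : UnitBall d, Summable fun α => (b α : ℂ) * (monomial α z * conj (monomial α w))) :
    (Matrix.of fun z w : UnitBall d =>
      (∑' α, (b α : ℂ) * (monomial α z * conj (monomial α w))) • S.starProjection).PosSemidef := by
  have e := (RKHS.posSemidef_tfae (K := Matrix.of fun z w : UnitBall d =>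
    (∑' α, (b α : ℂ) * (monomial α z * conj (monomial α w))) • S.starProjection)).out 2 0
  have hconj : ∀ z w : UnitBall d,
      conj (∑' α, (b α : ℂ) * (monomial α z * conj (monomial α w))) =
        ∑' α, (b α : ℂ) * (monomial α w * conj (monomial α z)) := by
    intro z w
    rw [Complex.conj_tsum]
    refine tsum_congr fun α => ?_
    simp [mul_comm]
  refine e.1 ⟨?_, fun vv => ?_⟩
  · ext1 z w
    rw [Matrix.conjTranspose_apply, Matrix.of_apply, Matrix.of_apply, star_smul,
      (isSelfAdjoint_starProjection S).star_eq, RCLike.star_def, hconj]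
  · have key : HasSum (fun α => (b α : ℂ) *
        ((‖∑ x ∈ vv.support, conj (monomial α x) • S.starProjection (vv x)‖ ^ 2 : ℝ) : ℂ))
        (vv.sum fun x w => vv.sum fun x' w' =>
          ⟪(Matrix.of (fun z w : UnitBall d =>
            (∑' α, (b α : ℂ) * (monomial α z * conj (monomial α w))) • S.starProjection)) x' x w,
            w'⟫_ℂ) := by
      have h0 : HasSum (fun α => ∑ x ∈ vv.support, ∑ x' ∈ vv.support,
          ((b α : ℂ) * (monomial α x * conj (monomial α x'))) *
            ⟪S.starProjection (vv x), vv x'⟫_ℂ)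
          (∑ x ∈ vv.support, ∑ x' ∈ vv.support,
            (∑' α, (b α : ℂ) * (monomial α x * conj (monomial α x'))) *
              ⟪S.starProjection (vv x), vv x'⟫_ℂ) :=
        hasSum_sum fun x _ => hasSum_sum fun x' _ => (hs x x').hasSum.mul_right _
      convert h0 using 1
      · ext α
        have h2 : ∀ x x', ⟪S.starProjection (vv x), S.starProjection (vv x')⟫_ℂ =
            ⟪S.starProjection (vv x), vv x'⟫_ℂ := by
          intro x x'
          rw [← S.inner_starProjection_left_eq_right,
            Submodule.starProjection_eq_self_iff.2 (Submodule.starProjection_apply_mem _ _)]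
        have h3 := inner_self_eq_norm_sq_to_K (𝕜 := ℂ)
          (∑ x ∈ vv.support, conj (monomial α x) • S.starProjection (vv x))
        rw [Complex.ofReal_pow]
        refine (congrArg (fun t => (b α : ℂ) * t) h3.symm).trans ?_
        simp only [sum_inner, inner_sum, inner_smul_left, inner_smul_right, h2, Finset.mul_sum,
          RCLike.conj_conj]
        rw [Finset.sum_comm]
        refine Finset.sum_congr rfl fun x _ => Finset.sum_congr rfl fun x' _ => ?_
        ring
      · simp only [Finsupp.sum, Matrix.of_apply, FunLike.coe_smul, Pi.smul_apply, inner_smul_left,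
          hconj]
    have := Complex.hasSum_re key
    refine this.nonneg fun α => ?_
    rw [← Complex.ofReal_mul, Complex.ofReal_re]
    exact mul_nonneg (hb α) (by positivity)

lemma kernel_eq_sum [∀ i, (T i).LocallyFinite] [∀ i, (T i).FiniteBranchingIndex]
    (a : ℕ) [NeZero a] (I : IndexingSystem T) (z w : UnitBall d) :
    kernel a I z w = ∑ F : Finset (Fin d), ∑ u ∈ (finite_solutionSpaceIn_ne_bot a I F).toFinset,
      scalarKernel T a u z w • (solutionSpaceIn T a u F).starProjection := by
  simp only [kernel, Matrix.of_apply]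
  refine Finset.sum_congr rfl fun F _ => ?_
  refine tsum_eq_sum fun u hu => ?_
  have : solutionSpaceIn T a u F = ⊥ := by simpa using hu
  simp [this]

lemma posSemidef_kernel [∀ i, (T i).LocallyFinite] [∀ i, (T i).FiniteBranchingIndex]
    (a : ℕ) [NeZero a] (I : IndexingSystem T) : (kernel a I).PosSemidef := by
  have h : kernel a I = ∑ F : Finset (Fin d),
      ∑ u ∈ (finite_solutionSpaceIn_ne_bot a I F).toFinset,
        Matrix.of fun z w => scalarKernel T a u z w • (solutionSpaceIn T a u F).starProjection := by
    ext1 z w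
    simp only [kernel_eq_sum, Matrix.sum_apply, Matrix.of_apply]
  rw [h]
  refine Matrix.posSemidef_sum _ fun F _ => Matrix.posSemidef_sum _ fun u _ => ?_
  exact posSemidef_diagonal _ (kernelCoeff T a u) (kernelCoeff_nonneg T a u)
    (summable_scalarKernel T a u _ (kernelCoeff_nonneg T a u) fun _ => le_rfl)

instance [∀ i, (T i).LocallyFinite] [∀ i, (T i).FiniteBranchingIndex]
    (a : ℕ) [NeZero a] (I : IndexingSystem T) : Fact (kernel a I).PosSemidef :=
  ⟨posSemidef_kernel a I⟩

/-! ### Multiplication by the coordinate functions -/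

lemma exists_mul_of_posSemidef {X E H : Type*} [NormedAddCommGroup E] [InnerProductSpace ℂ E]
    [CompleteSpace E] [NormedAddCommGroup H] [InnerProductSpace ℂ H] [CompleteSpace H]
    [RKHS ℂ H X E] (m : X → ℂ)
    (hm : (Matrix.of fun x y => (1 - m x * conj (m y)) • RKHS.kernel H x y).PosSemidef) :
    ∃ M : H →L[ℂ] H, ∀ f x, M f x = m x • f x := by
  let e : (X →₀ E) →ₗ[ℂ] H := Finsupp.lsum ℂ fun x => (RKHS.kerFun H x).toLinearMap
  let t : (X →₀ E) →ₗ[ℂ] H := Finsupp.lsum ℂ fun x => conj (m x) • (RKHS.kerFun H x).toLinearMap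
  have he : ∀ x v, e (Finsupp.single x v) = RKHS.kerFun H x v := fun x v => by simp [e]
  have ht : ∀ x v, t (Finsupp.single x v) = conj (m x) • RKHS.kerFun H x v := fun x v => by
    simp [t]
  have hdense : DenseRange e := by
    have h := RKHS.kerFun_dense (𝕜 := ℂ) H
    have hle : Submodule.span ℂ {RKHS.kerFun H x v | (x) (v)} ≤ LinearMap.range e := by
      rw [Submodule.span_le]
      rintro _ ⟨x, v, rfl⟩
      exact ⟨Finsupp.single x v, he x v⟩
    rw [DenseRange, dense_iff_closure_eq, Set.eq_univ_iff_forall]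
    intro y
    have hy : y ∈ (Submodule.span ℂ {RKHS.kerFun H x v | (x) (v)}).topologicalClosure := by
      rw [h]; trivial
    exact closure_mono (fun z hz => hle hz) hy
  have hbound : ∀ vv, ‖t vv‖ ≤ 1 * ‖e vv‖ := by
    intro vv
    have h0 := (RKHS.posSemidef_tfae (K := Matrix.of fun x y =>
      (1 - m x * conj (m y)) • RKHS.kernel H x y)).out 0 2
    have h := (h0.1 hm).2 vv
    have h1 : (vv.sum fun x w => vv.sum fun x' w' =>
        ⟪(Matrix.of fun x y => (1 - m x * conj (m y)) • RKHS.kernel H x y) x' x w, w'⟫_ℂ) =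
        ⟪e vv, e vv⟫_ℂ - ⟪t vv, t vv⟫_ℂ := by
      have h2 : e vv = ∑ x ∈ vv.support, RKHS.kerFun H x (vv x) := by
        simp [e, Finsupp.lsum_apply, Finsupp.sum]
      have h3 : t vv = ∑ x ∈ vv.support, conj (m x) • RKHS.kerFun H x (vv x) := by
        simp [t, Finsupp.lsum_apply, Finsupp.sum]
      rw [h2, h3]
      simp only [Finsupp.sum, sum_inner, inner_sum, ← Finset.sum_sub_distrib]
      rw [Finset.sum_comm]
      refine (Finset.sum_congr rfl fun x _ => Finset.sum_congr rfl fun x' _ => ?_)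
      simp only [Matrix.of_apply, FunLike.coe_smul, Pi.smul_apply, inner_smul_left,
        inner_smul_right, RKHS.kernel_inner, map_sub, map_mul, map_one, RCLike.conj_conj]
      ring
    rw [h1, map_sub, inner_self_eq_norm_sq, inner_self_eq_norm_sq, sub_nonneg] at h
    rw [one_mul]
    exact (sq_le_sq₀ (norm_nonneg _) (norm_nonneg _)).1 h
  refine ⟨ContinuousLinearMap.adjoint (t.extendOfNorm e), fun f x => ?_⟩
  refine ext_inner_left ℂ fun v => ?_
  rw [← RKHS.kerFun_inner, ContinuousLinearMap.adjoint_inner_right, ← he,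
    LinearMap.extendOfNorm_eq hdense ⟨1, hbound⟩, ht, inner_smul_left, RKHS.kerFun_inner,
    inner_smul_right, RCLike.conj_conj]

/-- The coefficients of `(1 - z_k conj(w_k)) κ_u(z, w)`. -/
lemma one_sub_mul_scalarKernel (a : ℕ) (u : ∀ i, V i) (k : Fin d) (z w : UnitBall d) :
    (1 - UnitBall.coord k z * conj (UnitBall.coord k w)) * scalarKernel T a u z w =
      ∑' α : Fin d → ℕ, ((kernelCoeff T a u α -
        (if α k = 0 then 0 else kernelCoeff T a u (α - Pi.single k 1)) : ℝ) : ℂ) *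
          (monomial α z * conj (monomial α w)) := by
  have hs := summable_scalarKernel T a u _ (kernelCoeff_nonneg T a u) (fun _ => le_rfl) z w
  have hm : ∀ (α : Fin d → ℕ) (z : UnitBall d),
      monomial (α + Pi.single k 1) z = UnitBall.coord k z * monomial α z := by
    intro α z
    simp only [monomial, Pi.add_apply, pow_add, Finset.prod_mul_distrib]
    rw [mul_comm]
    congr 1
    rw [Finset.prod_eq_single k] <;> simp +contextual
  have hinj : Function.Injective fun α : Fin d → ℕ => α + Pi.single k 1 :=
    fun _ _ h => add_right_cancel h
  set g : (Fin d → ℕ) → ℂ := fun α =>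
    ((if α k = 0 then 0 else kernelCoeff T a u (α - Pi.single k 1) : ℝ) : ℂ) *
      (monomial α z * conj (monomial α w)) with hg
  have hg1 : ∀ α, g (α + Pi.single k 1) =
      UnitBall.coord k z * conj (UnitBall.coord k w) *
        ((kernelCoeff T a u α : ℂ) * (monomial α z * conj (monomial α w))) := by
    intro α
    simp only [hg, hm, map_mul]
    simp
    ring
  have hsupp : ∀ α ∉ Set.range (fun α : Fin d → ℕ => α + Pi.single k 1), g α = 0 := by
    intro α hα
    have : α k = 0 := by
      by_contra h
      refine hα ⟨α - Pi.single k 1, ?_⟩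
      ext i
      by_cases hi : i = k
      · subst hi; simp; omega
      · simp [hi]
    simp [hg, this]
  have hg2 : HasSum g (UnitBall.coord k z * conj (UnitBall.coord k w) * scalarKernel T a u z w) := by
    rw [← hinj.hasSum_iff hsupp]
    refine HasSum.congr_fun ?_ hg1
    exact hs.hasSum.mul_left _
  have h := (hs.hasSum.sub hg2).tsum_eq
  rw [sub_mul, one_mul]
  refine h.symm.trans (tsum_congr fun α => ?_)
  simp only [hg, Complex.ofReal_sub]
  ring

lemma kernelCoeff_sub_single_le (a : ℕ) [NeZero a] (u : ∀ i, V i) (k : Fin d) (α : Fin d → ℕ) :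
    (if α k = 0 then 0 else kernelCoeff T a u (α - Pi.single k 1)) ≤ kernelCoeff T a u α := by
  split_ifs with h
  · exact kernelCoeff_nonneg T a u α
  obtain ⟨β, rfl⟩ : ∃ β : Fin d → ℕ, α = β + Pi.single k 1 := by
    refine ⟨α - Pi.single k 1, ?_⟩
    ext i
    by_cases hi : i = k
    · subst hi; simp; omega
    · simp [hi]
  rw [add_tsub_cancel_right]
  have ha : (1 : ℝ) ≤ a := by exact_mod_cast NeZero.one_le
  have hsum : ∑ i, (β + Pi.single k 1 : Fin d → ℕ) i = ∑ i, β i + 1 := by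
    simp [Finset.sum_add_distrib]
  have hprod : ∏ i, (depth T u i + (β + Pi.single k 1 : Fin d → ℕ) i)! =
      (∏ i, (depth T u i + β i)!) * (depth T u k + β k + 1) := by
    rw [← Finset.mul_prod_erase _ _ (Finset.mem_univ k),
      ← Finset.mul_prod_erase _ (fun i => (depth T u i + β i)!) (Finset.mem_univ k)]
    have : ∀ i ∈ Finset.univ.erase k, (depth T u i + (β + Pi.single k 1 : Fin d → ℕ) i)! =
        (depth T u i + β i)! := by
      intro i hi
      simp [(Finset.mem_erase.1 hi).1]
    rw [Finset.prod_congr rfl this]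
    simp only [Pi.add_apply, Pi.single_eq_same, ← add_assoc, Nat.factorial_succ]
    ring
  unfold kernelCoeff
  rw [hsum, hprod, Finset.prod_range_succ]
  have h1 : depth T u k ≤ height T u :=
    Finset.single_le_sum (f := fun i => depth T u i) (fun _ _ => Nat.zero_le _) (Finset.mem_univ k)
  have h2 : β k ≤ ∑ i, β i :=
    Finset.single_le_sum (f := fun i => β i) (fun _ _ => Nat.zero_le _) (Finset.mem_univ k)
  have h1' : (depth T u k : ℝ) ≤ height T u := by exact_mod_cast h1
  have h2' : (β k : ℝ) ≤ (∑ i, β i : ℕ) := by exact_mod_cast h2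
  set A : ℝ := ((∏ i, (depth T u i)! : ℕ) : ℝ)
  set B : ℝ := ((∏ i, (depth T u i + β i)! : ℕ) : ℝ) with hB
  set C : ℝ := ∏ j ∈ Finset.range (∑ i, β i), ((height T u : ℝ) + a + j)
  have hB0 : 0 < B := by rw [hB]; positivity
  have hAC : 0 ≤ A / B * C := by
    have : 0 ≤ A := by positivity
    have : 0 ≤ C := Finset.prod_nonneg fun _ _ => by positivity
    positivity
  have e : A / ((((∏ i, (depth T u i + β i)!) * (depth T u k + β k + 1) : ℕ)) : ℝ) *
      (C * ((height T u : ℝ) + a + (∑ i, β i : ℕ))) =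
      A / B * C * (((height T u : ℝ) + a + (∑ i, β i : ℕ)) / (depth T u k + β k + 1)) := by
    rw [Nat.cast_mul]
    push_cast [hB]
    field_simp
  rw [e]
  refine le_mul_of_one_le_right hAC ?_
  rw [one_le_div (by positivity)]
  linarith

lemma posSemidef_one_sub_mul_kernel [∀ i, (T i).LocallyFinite]
    [∀ i, (T i).FiniteBranchingIndex] (a : ℕ) [NeZero a] (I : IndexingSystem T) (k : Fin d) :
    (Matrix.of fun z w => (1 - UnitBall.coord k z * conj (UnitBall.coord k w)) •
      kernel a I z w).PosSemidef := by
  have h : (Matrix.of fun z w => (1 - UnitBall.coord k z * conj (UnitBall.coord k w)) •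
      kernel a I z w) = ∑ F : Finset (Fin d),
      ∑ u ∈ (finite_solutionSpaceIn_ne_bot a I F).toFinset,
        Matrix.of fun z w => (∑' α : Fin d → ℕ, ((kernelCoeff T a u α -
          (if α k = 0 then 0 else kernelCoeff T a u (α - Pi.single k 1)) : ℝ) : ℂ) *
          (monomial α z * conj (monomial α w))) • (solutionSpaceIn T a u F).starProjection := by
    ext1 z w
    simp only [kernel_eq_sum, Matrix.sum_apply, Matrix.of_apply, Finset.smul_sum, smul_smul,
      one_sub_mul_scalarKernel]
  have h0 : ∀ (u : ∀ i, V i) α, 0 ≤ kernelCoeff T a u α -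
      (if α k = 0 then 0 else kernelCoeff T a u (α - Pi.single k 1)) := fun u α =>
    sub_nonneg.2 (kernelCoeff_sub_single_le a u k α)
  rw [h]
  refine Matrix.posSemidef_sum _ fun F _ => Matrix.posSemidef_sum _ fun u _ => ?_
  refine posSemidef_diagonal _ _ (h0 u) (summable_scalarKernel T a u _ (h0 u) fun α => ?_)
  refine sub_le_self _ ?_
  split_ifs
  · exact le_rfl
  · exact kernelCoeff_nonneg T a u _

variable [∀ i, (T i).LocallyFinite] [∀ i, (T i).FiniteBranchingIndex]

/-- The Drury-Arveson-type space `ℋ_{𝔠_a}(𝒯)`: the reproducing kernel Hilbert space of `E`-valued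
functions on the open unit ball with reproducing kernel `kernel a I`. -/
abbrev DruryArveson (a : ℕ) [NeZero a] (I : IndexingSystem T) := RKHS.OfKernel (kernel a I)

lemma exists_mulCoord (a : ℕ) [NeZero a] (I : IndexingSystem T) (k : Fin d) :
    ∃ M : DruryArveson a I →L[ℂ] DruryArveson a I,
      ∀ f z, M f z = UnitBall.coord k z • f z := by
  refine exists_mul_of_posSemidef _ ?_
  rw [RKHS.OfKernel.kernel_ofKernel]
  exact posSemidef_one_sub_mul_kernel a I k

/-- The operator `ℳ_{z_k}` of multiplication by the `k`-th coordinate function. -/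
def mulCoord (a : ℕ) [NeZero a] (I : IndexingSystem T) (k : Fin d) :
    DruryArveson a I →L[ℂ] DruryArveson a I := (exists_mulCoord a I k).choose

lemma mulCoord_apply (a : ℕ) [NeZero a] (I : IndexingSystem T) (k : Fin d)
    (f : DruryArveson a I) (z : UnitBall d) :
    mulCoord a I k f z = UnitBall.coord k z • f z := (exists_mulCoord a I k).choose_spec f z

/-! ### Constant functions -/

/-- The centre of the unit ball. -/
def UnitBall.zero {d : ℕ} : UnitBall d := ⟨0, by simp⟩

/-- The embedding of `E` into `ℋ_{𝔠_a}(𝒯)` as the subspace of constant functions: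
`f ∈ E` is sent to the kernel function `κ(·, 0) f`, which is the constant function with value `f`. -/
def constFn (a : ℕ) [NeZero a] (I : IndexingSystem T) : jointKernel T a →L[ℂ] DruryArveson a I :=
  RKHS.kerFun (DruryArveson a I) UnitBall.zero

open Classical in
lemma constFn_apply (a : ℕ) [NeZero a] (I : IndexingSystem T) (f : jointKernel T a)
    (z : UnitBall d) : constFn a I f z = f := by
  rw [constFn, RKHS.kerFun_apply, RKHS.OfKernel.kernel_ofKernel, kernel_eq_sum]
  ext w
  simp only [scalarKernel_zero T a _ z UnitBall.zero rfl, one_smul]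
  simp only [sum_apply]
  let ev : jointKernel T a →ₗ[ℂ] ℂ :=
    { toFun := fun g => g.1 w, map_add' := fun _ _ => rfl, map_smul' := fun _ _ => rfl }
  change ev _ = ev f
  simp only [map_sum]
  have hev : ∀ F (u : I.Ω F), ev ((solutionSpaceIn T a u F).starProjection f) =
      if w ∈ sib T F u.1 then f.1 w else 0 := fun F u =>
    starProjection_apply T a u F (I.subset_Phi F u.2) f w
  let F₀ : Finset (Fin d) := Finset.univ.filter fun i => w i ≠ (T i).root
  have hF₀ : w ∈ Phi T F₀ := fun i => by simp [F₀]
  obtain ⟨u₀, ⟨hu₀, hwu⟩, huniq⟩ := I.existsUnique_mem F₀ w hF₀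
  have hsib : ∀ F (u : I.Ω F), w ∈ sib T F u.1 → F = F₀ := by
    intro F u hu
    have hu' := I.subset_Phi F u.2
    ext i
    rw [← hF₀ i]
    constructor
    · intro hi h
      exact (T i).not_adj_root _ (h ▸ (hu.2 i hi).2)
    · intro h
      by_contra hi
      rw [hu.1 i hi] at h
      exact hi ((hu' i).1 h)
  rw [Finset.sum_eq_single F₀, Finset.sum_eq_single ⟨u₀, hu₀⟩]
  · rw [hev, if_pos hwu]; rfl
  · intro u _ hne
    rw [hev, if_neg]
    intro h
    exact hne (Subtype.ext (huniq u.1 ⟨u.2, h⟩))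
  · intro h
    have hbot : solutionSpaceIn T a u₀ F₀ = ⊥ := by simpa using h
    simp [hbot]
  · intro F _ hF
    refine Finset.sum_eq_zero fun u _ => ?_
    rw [hev, if_neg]
    intro h; exact hF (hsib F u h)
  · simp

variable (T) in
open Classical in
/-- The indicator function `e_root` of the root. -/
def eRootFun : ℓ²((∀ i, V i), ℂ) := lp.single 2 (root T) (1 : ℂ)

variable (T) in
/-- `e_root` as an element of `E`. -/
def eRoot (a : ℕ) : jointKernel T a := ⟨eRootFun T, by
  classical
  rw [mem_jointKernel_iff]
  refine fun j v => finsum_mem_eq_zero_of_forall_eq_zero fun w hw => ?_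
  have hne : w ≠ root T := fun h => ((mem_childrenAt_iff T j v w).1 hw).1 (by rw [h]; rfl)
  simp [eRootFun, hne]⟩

/-- A Hilbert module isomorphism: a unitary map intertwining the multiplication operators by the
coordinate functions. -/
def IsHilbertModuleIso {V₁ V₂ : Fin d → Type*} {T₁ : ∀ i, RootedDirectedTree (V₁ i)}
    {T₂ : ∀ i, RootedDirectedTree (V₂ i)}
    [∀ i, (T₁ i).LocallyFinite] [∀ i, (T₁ i).FiniteBranchingIndex]
    [∀ i, (T₂ i).LocallyFinite] [∀ i, (T₂ i).FiniteBranchingIndex]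
    {a : ℕ} [NeZero a] {I₁ : IndexingSystem T₁} {I₂ : IndexingSystem T₂}
    (U : DruryArveson a I₁ ≃ₗᵢ[ℂ] DruryArveson a I₂) : Prop :=
  ∀ k f, U (mulCoord a I₁ k f) = mulCoord a I₂ k (U f)

/-- The direct sum of the spaces `𝓛_{u,F}` over all `u ∈ Ω_F` with `𝖽_u = α`, as a space of constant
functions in `ℋ_{𝔠_a}(𝒯)`. There are only finitely many such `u`, and the spaces `𝓛_{u,F}` are
finite dimensional and mutually orthogonal, so the orthogonal direct sum is the sum of subspaces. -/
def levelSpace (a : ℕ) [NeZero a] (I : IndexingSystem T) (α : Fin d → ℕ) (F : Finset (Fin d)) :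
    Submodule ℂ (DruryArveson a I) :=
  ⨆ u ∈ {u | u ∈ I.Ω F ∧ depth T u = α},
    (solutionSpaceIn T a u F).map (constFn a I).toLinearMap

end TreeProduct

end

noncomputable section

open scoped ComplexConjugate ComplexOrder InnerProductSpace lp Nat

namespace TreeProduct

open RootedDirectedTree

/-! ### Uniqueness of power series on the ball -/

/-! Write `D α` for the operator on `E` acting on each `𝓛_{u,F}` as the scalar coefficient of `z^α
conj(w)^α` in the kernel, so that `κ(z,w) = ∑ z^α conj(w)^α D α`. That scalar depends on `u` only
through its depth vector `n`; it is `depthCoeff a n α`.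

The constants are exactly the vectors orthogonal to the ranges of all `ℳ_{z_k}`
(`eq_constFn_of_inner_mulCoord`). Hence `U` carries constants to constants by a unitary `W : E₁ →
E₂` (`constMap`), and the intertwining relation gives `U (z^α g) = z^α (W g)` (`map_monomialFn`). In
either space `⟪z^α (D α f), z^α g⟫ = ⟪f, g⟫`, so `W` intertwines the operators `D α` of the two
spaces (`constMap_depthDiag`). It therefore respects their joint eigenspaces.

These eigenspaces are indexed by depth vectors: when `a * d ≠ 1` the family `α ↦ depthCoeff a n α`
determines `n`, already through its values at `ε_k` and `2 ε_k` (`eq_of_depthCoeff_eq`). For `a = d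
= 1` every coefficient equals `1` and the depth is lost. The vector `n` also determines `F` as its
set of nonzero entries, so a level space is either a full joint eigenspace or zero
(`mem_levelSpace_iff`, `isSupportedAt_iff`). At depth zero the eigenspace is the line through
`e_root`, which gives the last claim.

The analytic input is that the functions `z^α g` belong to the space, are total, and satisfy the
inner product formula above (`exists_monomialFn`). This follows from an explicit unitary equivalence
with `ℓ²(ℕ^d, E)` (`exists_linearIsometryEquiv_lp`), whose surjectivity rests on uniqueness of power
series coefficients. -/

lemma UnitBall.exists_coord_eq {d : ℕ} (t : UnitAddTorus (Fin d)) :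
    ∃ z : UnitBall d, ∀ i, UnitBall.coord i z = ((d + 1 : ℝ)⁻¹ : ℝ) * (t i).toCircle := by
  refine ⟨⟨WithLp.toLp 2 fun i => ((d + 1 : ℝ)⁻¹ : ℝ) * ((t i).toCircle : ℂ), ?_⟩, fun i => rfl⟩
  rw [mem_ball_zero_iff, EuclideanSpace.norm_eq, Real.sqrt_lt' one_pos]
  have h : ∀ i : Fin d, ‖(((d + 1 : ℝ)⁻¹ : ℝ) : ℂ) * ((t i).toCircle : ℂ)‖ = (d + 1 : ℝ)⁻¹ := by
    intro i
    rw [norm_mul, Complex.norm_real, Circle.norm_coe, mul_one, Real.norm_of_nonneg (by positivity)]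
  simp only [h, Finset.sum_const, Finset.card_univ, Fintype.card_fin, nsmul_eq_mul]
  have hd : (0 : ℝ) ≤ d := by positivity
  -- The radius `1 / (d + 1)` in every coordinate puts the torus inside the ball because `d / (d +
  -- 1) ^ 2 < 1`; it also makes sense for `d = 0`.
  rw [inv_pow, ← div_eq_mul_inv, div_lt_iff₀ (by positivity)]
  nlinarith

lemma monomial_eq_mFourier {d : ℕ} (α : Fin d → ℕ) (t : UnitAddTorus (Fin d)) (z : UnitBall d)
    (hz : ∀ i, UnitBall.coord i z = ((d + 1 : ℝ)⁻¹ : ℝ) * (t i).toCircle) :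
    monomial α z = (((d + 1 : ℝ)⁻¹ ^ ∑ i, α i : ℝ) : ℂ) *
      UnitAddTorus.mFourier (fun i => (α i : ℤ)) t := by
  simp only [monomial, hz, mul_pow, Finset.prod_mul_distrib, Finset.prod_pow_eq_pow_sum,
    UnitAddTorus.mFourier, ContinuousMap.coe_mk, fourier_apply]
  congr 1
  · push_cast; rfl
  · refine Finset.prod_congr rfl fun i _ => ?_
    rw [natCast_zsmul, AddCircle.toCircle_nsmul, Circle.coe_pow]

/-- A power series which vanishes on the unit ball has vanishing coefficients. -/
lemma eq_zero_of_hasSum_monomial {d : ℕ} (s : (Fin d → ℕ) → ℂ)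
    (hs : ∀ z : UnitBall d, HasSum (fun α => s α * monomial α z) 0) : s = 0 := by
  set r : ℝ := (d + 1 : ℝ)⁻¹ with hr
  have hr0 : 0 < r := by positivity
  let c : (Fin d → ℕ) → ℂ := fun α => s α * ((r ^ ∑ i, α i : ℝ) : ℂ)
  let e : (Fin d → ℕ) → Fin d → ℤ := fun α i => α i
  have he : Function.Injective e := fun α β h => funext fun i => by
    exact Int.ofNat_inj.1 (congrFun h i)
  -- Every term has constant modulus on the torus, so convergence at the single point `t = 0` gives
  -- absolute and uniform convergence on all of it.
  have hc : Summable fun α => ‖c α‖ := by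
    obtain ⟨z, hz⟩ := UnitBall.exists_coord_eq (d := d) 0
    refine (hs z).summable.norm.congr fun α => ?_
    rw [monomial_eq_mFourier α 0 z hz]
    simp [c, UnitAddTorus.mFourier, hr]
  have hsum : Summable fun α => c α • UnitAddTorus.mFourier (e α) := by
    refine Summable.of_norm ?_
    simpa [norm_smul, UnitAddTorus.mFourier_norm] using hc
  have hzero : HasSum (fun α => c α • UnitAddTorus.mFourier (e α)) 0 := by
    convert hsum.hasSum
    ext t
    obtain ⟨z, hz⟩ := UnitBall.exists_coord_eq t
    have h1 := (hsum.hasSum.mapL (ContinuousMap.evalCLM ℂ t))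
    have h2 := hs z
    refine h2.unique (HasSum.congr_fun h1 fun α => ?_)
    rw [monomial_eq_mFourier α t z hz]
    simp [c, e, mul_assoc, hr]
  funext β
  -- The uniformly convergent series is pushed into `L²` of the torus, where the characters are
  -- orthonormal and pairing with one of them isolates one coefficient. The local instances make the
  -- volume on each circle the normalised Haar measure.
  have hL : HasSum (fun α => c α • UnitAddTorus.mFourierLp (d := Fin d) 2 (e α)) 0 := by
    let _ : MeasureTheory.MeasureSpace UnitAddCircle := ⟨AddCircle.haarAddCircle⟩
    have : MeasureTheory.IsProbabilityMeasure
        (MeasureTheory.volume : MeasureTheory.Measure UnitAddCircle) :=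
      inferInstanceAs (MeasureTheory.IsProbabilityMeasure AddCircle.haarAddCircle)
    have h := hzero.mapL (ContinuousMap.toLp (E := ℂ) 2
      (MeasureTheory.volume : MeasureTheory.Measure (UnitAddTorus (Fin d))) ℂ)
    rw [map_zero] at h
    exact HasSum.congr_fun h fun α => (map_smul _ _ _).symm
  have h3 := hL.mapL (innerSL ℂ (UnitAddTorus.mFourierLp (d := Fin d) 2 (e β)))
  simp only [map_smul, innerSL_apply_apply, map_zero] at h3
  have horth := orthonormal_iff_ite.1 (UnitAddTorus.orthonormal_mFourier (d := Fin d))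
  have h5 := (hasSum_single β fun α hα => by
    rw [horth, if_neg fun h => hα (he h).symm, smul_zero]).unique h3
  have h7 : c β = 0 := by rwa [horth, if_pos rfl, smul_eq_mul, mul_one] at h5
  have : ((r ^ ∑ i, β i : ℝ) : ℂ) ≠ 0 := by
    exact_mod_cast (pow_pos hr0 _).ne'
  exact (mul_eq_zero.1 h7).resolve_right this

/-! ### Power series models of reproducing kernel Hilbert spaces on the ball -/

/-- Two densely defined linear maps with the same norms differ by a unitary map. -/
lemma exists_linearIsometryEquiv_of_norm_eq {X H K : Type*} [AddCommGroup X] [Module ℂ X]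
    [NormedAddCommGroup H] [InnerProductSpace ℂ H] [CompleteSpace H]
    [NormedAddCommGroup K] [InnerProductSpace ℂ K] [CompleteSpace K]
    (t : X →ₗ[ℂ] K) (e : X →ₗ[ℂ] H) (ht : DenseRange t) (he : DenseRange e)
    (hnorm : ∀ x, ‖e x‖ = ‖t x‖) : ∃ L : K ≃ₗᵢ[ℂ] H, ∀ x, L (t x) = e x :=
  ⟨(LinearEquiv.refl ℂ X).extendOfIsometry t e ht he hnorm,
    fun x => LinearEquiv.extendOfIsometry_eq (LinearEquiv.refl ℂ X) t e ht he hnorm x⟩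

/-- A reproducing kernel Hilbert space whose kernel is `∑_α z^α conj(w)^α A_α²`, with `A_α`
symmetric and injective, is unitarily equivalent to the space of square-summable sequences. -/
lemma exists_linearIsometryEquiv_lp {d : ℕ} {E H : Type*} [NormedAddCommGroup E]
    [InnerProductSpace ℂ E] [CompleteSpace E] [NormedAddCommGroup H] [InnerProductSpace ℂ H]
    [CompleteSpace H] [RKHS ℂ H (UnitBall d) E] (A : (Fin d → ℕ) → E →L[ℂ] E)
    (hA : ∀ α f g, ⟪A α f, g⟫_ℂ = ⟪f, A α g⟫_ℂ) (hA0 : ∀ α f, A α f = 0 → f = 0)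
    (hK : ∀ z w g, HasSum (fun α => (monomial α z * conj (monomial α w)) • A α (A α g))
      (RKHS.kernel H z w g)) :
    ∃ L : ℓ²(Fin d → ℕ, E) ≃ₗᵢ[ℂ] H,
      ∀ α k z, L (lp.single 2 α k) z = monomial α z • A α k := by
  have hterm : ∀ z w f g α, ⟪conj (monomial α z) • A α f, conj (monomial α w) • A α g⟫_ℂ =
      ⟪f, (monomial α z * conj (monomial α w)) • A α (A α g)⟫_ℂ := by
    intro z w f g α
    rw [inner_smul_left, inner_smul_right, inner_smul_right, hA, RCLike.conj_conj, mul_assoc]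
  have hinner : ∀ z w f g, HasSum (fun α =>
      ⟪conj (monomial α z) • A α f, conj (monomial α w) • A α g⟫_ℂ)
      ⟪f, RKHS.kernel H z w g⟫_ℂ := by
    intro z w f g
    simp only [hterm]
    exact (hK z w g).mapL (innerSL ℂ f)
  -- Square-summability is convergence of the kernel series on the diagonal `z = w`.
  have hmem : ∀ z g, Memℓp (fun α => conj (monomial α z) • A α g) 2 := by
    intro z g
    refine memℓp_gen ?_
    have h := (hinner z z g g).summable.norm
    refine h.congr fun α => ?_
    rw [inner_self_eq_norm_sq_to_K]
    simp
  -- `κ z g` is the sequence that represents the kernel function at `z` in direction `g`; the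
  -- unitary will match the two.
  let κ : UnitBall d → E →ₗ[ℂ] ℓ²(Fin d → ℕ, E) := fun z =>
    { toFun := fun g => ⟨_, hmem z g⟩
      map_add' := fun f g => by ext α; exact (congrArg _ (map_add _ _ _)).trans (smul_add _ _ _)
      map_smul' := fun c g => by
        ext α; exact (congrArg _ (map_smul _ _ _)).trans (smul_comm _ _ _) }
  have hκ : ∀ z g α, κ z g α = conj (monomial α z) • A α g := fun _ _ _ => rfl
  have hκκ : ∀ z w f g, ⟪κ z f, κ w g⟫_ℂ = ⟪RKHS.kerFun H z f, RKHS.kerFun H w g⟫_ℂ := by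
    intro z w f g
    rw [RKHS.kerFun_inner, RKHS.kerFun_apply]
    exact (lp.hasSum_inner (κ z f) (κ w g)).unique (hinner z w f g)
  let e : (UnitBall d →₀ E) →ₗ[ℂ] H := Finsupp.lsum ℂ fun x => (RKHS.kerFun H x).toLinearMap
  let t : (UnitBall d →₀ E) →ₗ[ℂ] ℓ²(Fin d → ℕ, E) := Finsupp.lsum ℂ κ
  have he : ∀ x v, e (Finsupp.single x v) = RKHS.kerFun H x v := fun x v => by simp [e]
  have ht : ∀ x v, t (Finsupp.single x v) = κ x v := fun x v => by simp [t]
  have hde : DenseRange e := by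
    have h := RKHS.kerFun_dense (𝕜 := ℂ) H
    have hle : Submodule.span ℂ {RKHS.kerFun H x v | (x) (v)} ≤ LinearMap.range e := by
      rw [Submodule.span_le]
      rintro _ ⟨x, v, rfl⟩
      exact ⟨Finsupp.single x v, he x v⟩
    exact (Submodule.dense_iff_topologicalClosure_eq_top (s := LinearMap.range e)).2
      (top_unique (h ▸ Submodule.topologicalClosure_mono hle))
  have hdt : DenseRange t := by
    -- For `k` orthogonal to every `κ z g`, the power series `∑ ⟪g, A α (k α)⟫ z^α` vanishes on the
    -- ball. Its coefficients are then zero, and injectivity of each `A α` gives `k = 0`.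
    have h : (LinearMap.range t).topologicalClosure = ⊤ := by
      rw [Submodule.topologicalClosure_eq_top_iff, Submodule.eq_bot_iff]
      intro k hk
      have hk' : ∀ z g, ⟪κ z g, k⟫_ℂ = 0 := fun z g => hk _ ⟨Finsupp.single z g, ht z g⟩
      ext α
      refine hA0 α _ (ext_inner_left ℂ fun g => ?_)
      have h0 : (fun α => ⟪g, A α (k α)⟫_ℂ) = 0 := by
        refine eq_zero_of_hasSum_monomial _ fun z => ?_
        rw [← hk' z g]
        refine HasSum.congr_fun (lp.hasSum_inner (κ z g) k) fun α => ?_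
        rw [hκ, inner_smul_left, RCLike.conj_conj, hA, mul_comm]
      rw [inner_zero_right]
      exact congrFun h0 α
    exact Submodule.dense_iff_topologicalClosure_eq_top.2 h
  have hnorm : ∀ v, ‖e v‖ = ‖t v‖ := by
    intro v
    have h1 : t v = ∑ x ∈ v.support, κ x (v x) := by simp [t, Finsupp.sum]
    have h2 : e v = ∑ x ∈ v.support, RKHS.kerFun H x (v x) := by simp [e, Finsupp.sum]
    have h : ⟪t v, t v⟫_ℂ = ⟪e v, e v⟫_ℂ := by
      rw [h1, h2, sum_inner, sum_inner]
      simp_rw [inner_sum]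
      exact Finset.sum_congr rfl fun x _ => Finset.sum_congr rfl fun y _ => hκκ x y _ _
    rw [norm_eq_sqrt_re_inner (𝕜 := ℂ) (e v), norm_eq_sqrt_re_inner (𝕜 := ℂ) (t v), h]
  obtain ⟨L, hLt⟩ := exists_linearIsometryEquiv_of_norm_eq t e hdt hde hnorm
  have hL : ∀ z g, L (κ z g) = RKHS.kerFun H z g := fun z g => by rw [← ht, ← he, hLt]
  -- By the reproducing property, a value at `z` is read off by pairing with kernel functions, and
  -- these are images under `L`.
  refine ⟨L, fun α k z => ext_inner_left ℂ fun g => ?_⟩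
  rw [← RKHS.kerFun_inner, ← hL, L.inner_map_map, lp.inner_single_right, hκ, inner_smul_left,
    inner_smul_right, RCLike.conj_conj, hA]

end TreeProduct

/-! ### Depth in a single rooted tree. -/

namespace RootedDirectedTree

variable {V : Type*} (T : RootedDirectedTree V)

lemma depth_eq_zero_iff (v : V) : T.depth v = 0 ↔ v = T.root := by
  constructor
  · intro h
    simpa [h] using T.iterate_depth v
  · rintro rfl
    exact Nat.sInf_eq_zero.2 (Or.inl rfl)

lemma depth_eq_of_ne_root {v : V} (h : v ≠ T.root) : T.depth v = T.depth (T.parent v) + 1 := by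
  refine le_antisymm (Nat.sInf_le ?_) ?_
  · exact T.iterate_depth (T.parent v)
  · obtain ⟨n, hn⟩ := Nat.exists_eq_succ_of_ne_zero ((T.depth_eq_zero_iff v).not.2 h)
    have hv := T.iterate_depth v
    rw [hn, Function.iterate_succ_apply] at hv
    rw [hn]
    exact Nat.succ_le_succ (Nat.sInf_le hv)

lemma depth_eq_of_mem_siblings {v w : V} (h : w ∈ T.siblings v) : T.depth w = T.depth v := by
  have hw : w ≠ T.root := fun h0 => T.not_adj_root _ (h0 ▸ h.2)
  rw [T.depth_eq_of_ne_root h.1, T.depth_eq_of_ne_root hw, T.parent_eq h.2]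

end RootedDirectedTree

namespace TreeProduct

open RootedDirectedTree

/-! ### Depth vectors -/

section Depth

variable {d : ℕ} {V : Fin d → Type*} (T : ∀ i, RootedDirectedTree (V i))

lemma depth_eq_zero_iff (v : ∀ i, V i) : depth T v = 0 ↔ v = root T := by
  simp only [funext_iff, depth, root, Pi.zero_apply, RootedDirectedTree.depth_eq_zero_iff]

/-- The root is the only vertex of depth zero, so the depth vector alone decides which `Φ_F`
contains a vertex. This is why `F` needs no invariant of its own. -/
lemma mem_Phi_iff (F : Finset (Fin d)) (v : ∀ i, V i) :
    v ∈ Phi T F ↔ F = Finset.univ.filter fun i => depth T v i ≠ 0 := by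
  have h : ∀ i, v i ≠ (T i).root ↔ depth T v i ≠ 0 := fun i =>
    ((T i).depth_eq_zero_iff (v i)).not.symm
  rw [Finset.ext_iff]
  refine forall_congr' fun i => ?_
  rw [Finset.mem_filter_univ, h]
  exact Iff.comm

lemma depth_eq_of_mem_sib {F : Finset (Fin d)} {u v : ∀ i, V i} (h : v ∈ sib T F u) :
    depth T v = depth T u := by
  funext i
  by_cases hi : i ∈ F
  · exact (T i).depth_eq_of_mem_siblings (h.2 i hi)
  · simp only [depth, h.1 i hi]

end Depth

/-! ### The coefficients of the kernel -/

/-- The coefficient `n! / (n + α)! ∏_{j < |α|} (|n| + a + j)`. -/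
def depthCoeff {d : ℕ} (a : ℕ) (n α : Fin d → ℕ) : ℝ :=
  ((∏ i, (n i)! : ℕ) : ℝ) / ((∏ i, (n i + α i)! : ℕ) : ℝ) *
    ∏ j ∈ Finset.range (∑ i, α i), (((∑ i, n i : ℕ) : ℝ) + a + j)

/-- The tree enters the kernel coefficient only through the depth vector, whose entries sum to the
height. Coefficients belonging to different trees thereby become comparable. -/
lemma kernelCoeff_eq_depthCoeff {d : ℕ} {V : Fin d → Type*} (T : ∀ i, RootedDirectedTree (V i))
    (a : ℕ) (u : ∀ i, V i) (α : Fin d → ℕ) :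
    kernelCoeff T a u α = depthCoeff a (depth T u) α := rfl

lemma depthCoeff_pos {d : ℕ} (a : ℕ) [NeZero a] (n α : Fin d → ℕ) : 0 < depthCoeff a n α := by
  have ha : (0 : ℝ) < a := by exact_mod_cast Nat.pos_of_neZero a
  unfold depthCoeff
  have : 0 < ∏ j ∈ Finset.range (∑ i, α i), (((∑ i, n i : ℕ) : ℝ) + a + j) :=
    Finset.prod_pos fun j _ => by positivity
  positivity

lemma prod_factorial_add_single {d : ℕ} (n : Fin d → ℕ) (k : Fin d) (m : ℕ) :
    (∏ i, (n i + (Pi.single k m : Fin d → ℕ) i)!) * (n k)! = (∏ i, (n i)!) * (n k + m)! := by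
  rw [← Finset.mul_prod_erase _ _ (Finset.mem_univ k),
    ← Finset.mul_prod_erase _ (fun i => (n i)!) (Finset.mem_univ k)]
  have : ∀ i ∈ Finset.univ.erase k, (n i + (Pi.single k m : Fin d → ℕ) i)! = (n i)! := by
    intro i hi
    simp [(Finset.mem_erase.1 hi).1]
  rw [Finset.prod_congr rfl this, Pi.single_eq_same]
  ring

lemma depthCoeff_single {d : ℕ} (a : ℕ) (n : Fin d → ℕ) (k : Fin d) (m : ℕ) :
    depthCoeff a n (Pi.single k m) = ((n k)! : ℝ) / (n k + m)! *
      ∏ j ∈ Finset.range m, (((∑ i, n i : ℕ) : ℝ) + a + j) := by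
  have h : ((∏ i, (n i + (Pi.single k m : Fin d → ℕ) i)! : ℕ) : ℝ) * (n k)! =
      ((∏ i, (n i)! : ℕ) : ℝ) * (n k + m)! := by
    exact_mod_cast prod_factorial_add_single n k m
  have hs : ∑ i, (Pi.single k m : Fin d → ℕ) i = m := by simp
  rw [depthCoeff, hs]
  congr 1
  rw [div_eq_div_iff (by positivity) (by positivity)]
  linarith

/-- The coefficients of the kernel separate the depth vectors. -/
lemma eq_of_depthCoeff_eq {d a : ℕ} [NeZero d] [NeZero a] (had : a * d ≠ 1) {n m : Fin d → ℕ}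
    (h : ∀ α, depthCoeff a n α = depthCoeff a m α) : n = m := by
  have ha : (1 : ℝ) ≤ a := by exact_mod_cast NeZero.one_le
  set N : ℝ := ((∑ i, n i : ℕ) : ℝ) with hN
  set M : ℝ := ((∑ i, m i : ℕ) : ℝ) with hM
  have hN0 : 0 ≤ N := Nat.cast_nonneg _
  have hM0 : 0 ≤ M := Nat.cast_nonneg _
  -- Equality of the coefficients at `ε_k`, which are `(N + a) / (n k + 1)` and `(M + a) / (m k +
  -- 1)`.
  have h1 : ∀ k, (N + a) * (m k + 1) = (M + a) * (n k + 1) := by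
    intro k
    have := h (Pi.single k 1)
    rw [depthCoeff_single, depthCoeff_single, Finset.prod_range_one, Finset.prod_range_one,
      Nat.factorial_succ, Nat.factorial_succ, ← hN, ← hM] at this
    push_cast at this
    field_simp at this
    linarith
  have h2 : ∀ k, (N + a + 1) * (m k + 2) = (M + a + 1) * (n k + 2) := by
    intro k
    have := h (Pi.single k 2)
    rw [depthCoeff_single, depthCoeff_single, Finset.prod_range_succ, Finset.prod_range_one,
      Finset.prod_range_succ, Finset.prod_range_one,
      Nat.factorial_succ, Nat.factorial_succ, Nat.factorial_succ, Nat.factorial_succ,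
      ← hN, ← hM] at this
    push_cast at this
    field_simp at this
    have h3 := h1 k
    -- The coefficient at `2 ε_k` contains the one at `ε_k` as a factor; dividing it out leaves the
    -- relation between the second factors.
    have h4 : (N + a) * (m k + 1) ≠ 0 := by positivity
    refine mul_left_cancel₀ h4 ?_
    linear_combination this - (M + a + 1) * (n k + 2) * h3
  -- Eliminating `m k` between the two relations leaves a product: either the heights agree, and
  -- then `h1` gives `n = m`, or `N + a = n k + 1` for every `k`.
  have hkey : ∀ k, (M - N) * (N + a - (n k + 1)) = 0 := by
    intro k
    have e1 := h1 k
    have e2 := h2 k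
    linear_combination (N + a + 1) * e1 - (N + a) * e2
  have hkey' : ∀ k, (M - N) * (M + a - (m k + 1)) = 0 := by
    intro k
    have e1 := h1 k
    have e2 := h2 k
    linear_combination (M + a + 1) * e1 - (M + a) * e2
  by_cases hMN : M = N
  · funext k
    have e1 := h1 k
    rw [hMN] at e1
    have := mul_left_cancel₀ (by positivity : N + a ≠ 0) e1
    have : (m k : ℝ) = n k := by linarith
    exact_mod_cast this.symm
  -- In the exceptional case the height `|p|` is at least `p k`, which forces `a = 1` and `|p| = p
  -- k` for all `k`. Then `d ≥ 2` by `a * d ≠ 1`, and a sum of at least two entries can equal each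
  -- of them only if `p = 0`. Applied to both `n` and `m`, this still yields `n = m`.
  · have hz : ∀ p : Fin d → ℕ, (∀ k, ((∑ i, p i : ℕ) : ℝ) + a - (p k + 1) = 0) → p = 0 := by
      intro p hp
      have hp' : ∀ k, ∑ i, p i + a = p k + 1 := by
        intro k
        have := hp k
        have : ((∑ i, p i : ℕ) : ℝ) + a = p k + 1 := by linarith
        exact_mod_cast this
      have ha1 : a = 1 := by
        have := hp' 0
        have := Finset.single_le_sum (f := p) (fun _ _ => Nat.zero_le _) (Finset.mem_univ 0)
        have := NeZero.one_le (n := a)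
        omega
      funext k
      obtain ⟨l, hl⟩ : ∃ l, l ≠ k := by
        by_contra hcon
        push Not at hcon
        have : Fintype.card (Fin d) ≤ 1 :=
          Fintype.card_le_one_iff.2 fun x y => (hcon x).trans (hcon y).symm
        rw [Fintype.card_fin] at this
        have := NeZero.one_le (n := d)
        exact had (by rw [ha1]; omega)
      have e := hp' l
      have : p k + p l ≤ ∑ i, p i := by
        rw [← Finset.sum_pair hl.symm]
        exact Finset.sum_le_sum_of_subset (Finset.subset_univ _)
      simp only [Pi.zero_apply]
      omega
    have hsub : M - N ≠ 0 := sub_ne_zero.2 hMN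
    rw [hz n fun k => (mul_eq_zero.1 (hkey k)).resolve_left hsub,
      hz m fun k => (mul_eq_zero.1 (hkey' k)).resolve_left hsub]

/-! ### Operators on `E` which are diagonal with respect to the depth -/

lemma jointKernel_ext {d : ℕ} {V : Fin d → Type*} {T : ∀ i, RootedDirectedTree (V i)}
    [∀ i, (T i).LocallyFinite] {a : ℕ} {f g : jointKernel T a} (h : ∀ w, f.1 w = g.1 w) : f = g :=
  Subtype.ext (lp.ext (funext h))

variable {d : ℕ} {V : Fin d → Type*} {T : ∀ i, RootedDirectedTree (V i)}
  [∀ i, (T i).LocallyFinite] [∀ i, (T i).FiniteBranchingIndex]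

/-- The operator on `E` which is multiplication by `b (depth T u)` on each `𝓛_{u,F}`. -/
def depthDiag (a : ℕ) [NeZero a] (I : IndexingSystem T) (b : (Fin d → ℕ) → ℝ) :
    jointKernel T a →L[ℂ] jointKernel T a :=
  ∑ F : Finset (Fin d), ∑ u ∈ (finite_solutionSpaceIn_ne_bot a I F).toFinset,
    (b (depth T u) : ℂ) • (solutionSpaceIn T a u F).starProjection

/-- Each vertex lies in exactly one class `sib_F(u)`, and all members of a class have the depth
vector of `u`. So the operator is pointwise multiplication by a function of the depth, which makes
composition, inversion and symmetry immediate. No bound on `b` is needed, since only finitely many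
`𝓛_{u,F}` are nonzero. -/
lemma depthDiag_apply (a : ℕ) [NeZero a] (I : IndexingSystem T) (b : (Fin d → ℕ) → ℝ)
    (f : jointKernel T a) (w : ∀ i, V i) :
    (depthDiag a I b f).1 w = (b (depth T w) : ℂ) * f.1 w := by
  classical
  let ev : jointKernel T a →ₗ[ℂ] ℂ :=
    { toFun := fun g => g.1 w, map_add' := fun _ _ => rfl, map_smul' := fun _ _ => rfl }
  change ev _ = _ * ev f
  have hev : ∀ F (u : I.Ω F), ev ((solutionSpaceIn T a u F).starProjection f) =
      if w ∈ sib T F u.1 then f.1 w else 0 := fun F u =>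
    starProjection_apply T a u F (I.subset_Phi F u.2) f w
  simp only [depthDiag, sum_apply, FunLike.coe_smul, Pi.smul_apply, map_sum,
    map_smul, smul_eq_mul]
  let F₀ : Finset (Fin d) := Finset.univ.filter fun i => depth T w i ≠ 0
  have hw : w ∈ Phi T F₀ := (mem_Phi_iff T _ _).2 rfl
  obtain ⟨u₀, ⟨hu₀, hwu⟩, huniq⟩ := I.existsUnique_mem F₀ w hw
  have hsib : ∀ F (u : I.Ω F), w ∈ sib T F u.1 → F = F₀ := by
    intro F u hu
    rw [(mem_Phi_iff T _ _).1 (I.subset_Phi F u.2), ← depth_eq_of_mem_sib T hu]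
  rw [Finset.sum_eq_single F₀, Finset.sum_eq_single ⟨u₀, hu₀⟩]
  · rw [hev, if_pos hwu, ← depth_eq_of_mem_sib T hwu]; rfl
  · intro u _ hne
    rw [hev, if_neg fun h => hne (Subtype.ext (huniq u.1 ⟨u.2, h⟩)), mul_zero]
  -- The class of `w` may be missing from the finite sum; its space is then zero, and so is the term
  -- it would have contributed.
  · intro h
    have hbot : solutionSpaceIn T a u₀ F₀ = ⊥ := by simpa using h
    simp [hbot]
  · intro F _ hF
    refine Finset.sum_eq_zero fun u _ => ?_
    rw [hev, if_neg fun h => hF (hsib F u h), mul_zero]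
  · simp

lemma depthDiag_depthDiag (a : ℕ) [NeZero a] (I : IndexingSystem T) (b c : (Fin d → ℕ) → ℝ)
    (f : jointKernel T a) :
    depthDiag a I b (depthDiag a I c f) = depthDiag a I (fun n => b n * c n) f := by
  refine jointKernel_ext fun w => ?_
  simp only [depthDiag_apply, Complex.ofReal_mul, mul_assoc]

lemma depthDiag_one (a : ℕ) [NeZero a] (I : IndexingSystem T) (f : jointKernel T a) :
    depthDiag a I (fun _ => 1) f = f := by
  refine jointKernel_ext fun w => ?_
  simp only [depthDiag_apply, Complex.ofReal_one, one_mul]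

lemma inner_depthDiag_left (a : ℕ) [NeZero a] (I : IndexingSystem T) (b : (Fin d → ℕ) → ℝ)
    (f g : jointKernel T a) : ⟪depthDiag a I b f, g⟫_ℂ = ⟪f, depthDiag a I b g⟫_ℂ := by
  rw [Submodule.coe_inner, Submodule.coe_inner, lp.inner_eq_tsum, lp.inner_eq_tsum]
  refine tsum_congr fun w => ?_
  rw [depthDiag_apply, depthDiag_apply]
  simp
  ring

/-- The kernel is regrouped by powers of `z` instead of by vertices; the sum over `F` and `u` is
finite, so it passes through the series. -/
lemma hasSum_kernel (a : ℕ) [NeZero a] (I : IndexingSystem T) (z w : UnitBall d)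
    (g : jointKernel T a) :
    HasSum (fun α => (monomial α z * conj (monomial α w)) •
      depthDiag a I (fun n => depthCoeff a n α) g) (kernel a I z w g) := by
  rw [kernel_eq_sum]
  simp only [depthDiag, sum_apply, FunLike.coe_smul, Pi.smul_apply,
    Finset.smul_sum, smul_smul]
  refine hasSum_sum fun F _ => hasSum_sum fun u _ => HasSum.smul_const ?_ _
  refine HasSum.congr_fun (summable_scalarKernel T a u.1 _ (kernelCoeff_nonneg T a u.1)
    (fun _ => le_rfl) z w).hasSum fun α => ?_
  rw [kernelCoeff_eq_depthCoeff, mul_comm]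

/-! ### Monomials with coefficients in `E` -/

/-- The model is applied with `A α` the square root of the coefficient operator, which is invertible
because all coefficients are positive; `z^α g` is then the image of the sequence with single entry
`(A α)⁻¹ g`. The last clause says that `⟪z^α f, z^α g⟫ = ⟪(A α)⁻² f, g⟫`, with the inverse cleared.
-/
lemma exists_monomialFn (a : ℕ) [NeZero a] (I : IndexingSystem T) :
    ∃ m : (Fin d → ℕ) → jointKernel T a → DruryArveson a I,
      (∀ α g z, m α g z = monomial α z • g) ∧
      (∀ x, (∀ α g, ⟪x, m α g⟫_ℂ = 0) → x = 0) ∧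
      ∀ α f g, ⟪m α (depthDiag a I (fun n => depthCoeff a n α) f), m α g⟫_ℂ = ⟪f, g⟫_ℂ := by
  classical
  let A : (Fin d → ℕ) → jointKernel T a →L[ℂ] jointKernel T a := fun α =>
    depthDiag a I fun n => √(depthCoeff a n α)
  let B : (Fin d → ℕ) → jointKernel T a →L[ℂ] jointKernel T a := fun α =>
    depthDiag a I fun n => (√(depthCoeff a n α))⁻¹
  have hpos : ∀ n α : Fin d → ℕ, √(depthCoeff a n α) ≠ 0 := fun n α =>
    (Real.sqrt_pos.2 (depthCoeff_pos a n α)).ne'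
  have hAA : ∀ α f, A α (A α f) = depthDiag a I (fun n => depthCoeff a n α) f := by
    intro α f
    simp only [A, depthDiag_depthDiag, Real.mul_self_sqrt (depthCoeff_pos a _ α).le]
  have hAB : ∀ α f, A α (B α f) = f := by
    intro α f
    simp only [A, B, depthDiag_depthDiag, mul_inv_cancel₀ (hpos _ α), depthDiag_one]
  have hBA : ∀ α f, B α (A α f) = f := by
    intro α f
    simp only [A, B, depthDiag_depthDiag, inv_mul_cancel₀ (hpos _ α), depthDiag_one]
  obtain ⟨L, hL⟩ := exists_linearIsometryEquiv_lp (H := DruryArveson a I) A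
    (fun α f g => inner_depthDiag_left a I _ f g)
    (fun α f h => by rw [← hBA α f, h, map_zero])
    (fun z w g => by
      simp only [hAA, RKHS.OfKernel.kernel_ofKernel]
      exact hasSum_kernel a I z w g)
  refine ⟨fun α g => L (lp.single 2 α (B α g)), fun α g z => by rw [hL, hAB], fun x hx => ?_,
    fun α f g => ?_⟩
  -- Testing against `A α g` cancels the inverse, so every single-entry sequence is reached.
  · rw [← L.apply_symm_apply x, L.map_eq_zero_iff]
    ext1
    funext α
    refine ext_inner_right ℂ fun g => ?_
    have := hx α (A α g)
    beta_reduce at this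
    rw [hBA, ← L.apply_symm_apply x, L.inner_map_map, lp.inner_single_right] at this
    rw [this]; simp
  · rw [L.inner_map_map, lp.inner_single_right, lp.single_apply_self, ← hAA, hBA]
    exact (inner_depthDiag_left a I _ f _).trans (by rw [show depthDiag a I _ (B α g) = g from hAB α g])

lemma monomial_zero {d : ℕ} (z : UnitBall d) : monomial 0 z = 1 := by simp [monomial]

lemma monomial_add_single {d : ℕ} (α : Fin d → ℕ) (k : Fin d) (z : UnitBall d) :
    monomial (α + Pi.single k 1) z = UnitBall.coord k z * monomial α z := by
  simp only [monomial, Pi.add_apply, pow_add, Finset.prod_mul_distrib]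
  rw [mul_comm]
  congr 1
  rw [Finset.prod_eq_single k] <;> simp +contextual

/-- Induction on multi-indices, raising one entry at a time. -/
lemma multiIndex_induction {d : ℕ} {P : (Fin d → ℕ) → Prop} (h0 : P 0)
    (h1 : ∀ α k, P α → P (α + Pi.single k 1)) (α : Fin d → ℕ) : P α := by
  induction hn : ∑ i, α i generalizing α with
  | zero =>
    have : α = 0 := funext fun i => (Finset.sum_eq_zero_iff.1 hn) i (Finset.mem_univ i)
    rwa [this]
  | succ n ih =>
    obtain ⟨k, -, hk⟩ := Finset.exists_ne_zero_of_sum_ne_zero (hn.trans_ne n.succ_ne_zero)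
    have hα : α = (α - Pi.single k 1) + Pi.single k 1 := by
      ext i
      by_cases hi : i = k
      · subst hi; simp; omega
      · simp [hi]
    rw [hα] at hn ⊢
    refine h1 _ k (ih _ ?_)
    simpa [Finset.sum_add_distrib] using hn

/-! ### Elements of `E` supported at one depth vector. -/

section Support

variable {d : ℕ} {V : Fin d → Type*} {T : ∀ i, RootedDirectedTree (V i)}
  [∀ i, (T i).LocallyFinite] (a : ℕ)

/-- `g` is supported on the vertices of `Φ_F` of depth `n`. -/
def IsSupportedAt (n : Fin d → ℕ) (F : Finset (Fin d)) (g : jointKernel T a) : Prop :=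
  ∀ v, g.1 v ≠ 0 → depth T v = n ∧ v ∈ Phi T F

/-- The condition splits into one on depths, which the isomorphism will be shown to preserve, and
one relating only `n` and `F` that matters when `g ≠ 0`. -/
lemma isSupportedAt_iff {n : Fin d → ℕ} {F : Finset (Fin d)} {g : jointKernel T a} :
    IsSupportedAt a n F g ↔ (∀ v, g.1 v ≠ 0 → depth T v = n) ∧
      (g ≠ 0 → F = Finset.univ.filter fun i => n i ≠ 0) := by
  simp only [IsSupportedAt, mem_Phi_iff]
  constructor
  · refine fun h => ⟨fun v hv => (h v hv).1, fun hg => ?_⟩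
    by_contra hF
    refine hg (jointKernel_ext fun v => ?_)
    by_contra hv
    obtain ⟨h1, h2⟩ := h v hv
    rw [h1] at h2
    exact hF h2
  · rintro ⟨h1, h2⟩ v hv
    refine ⟨h1 v hv, ?_⟩
    rw [h1 v hv]
    exact h2 fun h0 => hv (by rw [h0]; rfl)

end Support

/-! ### Monomials, constants and level spaces inside the Hilbert module. -/

section Module

variable {d : ℕ} {V : Fin d → Type*} {T : ∀ i, RootedDirectedTree (V i)}
  [∀ i, (T i).LocallyFinite] [∀ i, (T i).FiniteBranchingIndex]

/-- The function `z ↦ z^α g` in `ℋ_{𝔠_a}(𝒯)`. -/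
def monomialFn (a : ℕ) [NeZero a] (I : IndexingSystem T) (α : Fin d → ℕ) (g : jointKernel T a) :
    DruryArveson a I := (exists_monomialFn a I).choose α g

variable (a : ℕ) [NeZero a] (I : IndexingSystem T)

lemma monomialFn_apply (α : Fin d → ℕ) (g : jointKernel T a) (z : UnitBall d) :
    monomialFn a I α g z = monomial α z • g := (exists_monomialFn a I).choose_spec.1 α g z

lemma eq_zero_of_inner_monomialFn {x : DruryArveson a I}
    (h : ∀ α g, ⟪x, monomialFn a I α g⟫_ℂ = 0) : x = 0 :=
  (exists_monomialFn a I).choose_spec.2.1 x h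

lemma inner_monomialFn_depthDiag (α : Fin d → ℕ) (f g : jointKernel T a) :
    ⟪monomialFn a I α (depthDiag a I (fun n => depthCoeff a n α) f), monomialFn a I α g⟫_ℂ =
      ⟪f, g⟫_ℂ := (exists_monomialFn a I).choose_spec.2.2 α f g

lemma monomialFn_zero (g : jointKernel T a) : monomialFn a I 0 g = constFn a I g :=
  RKHS.ext fun z => by rw [monomialFn_apply, monomial_zero, one_smul, constFn_apply]

lemma mulCoord_monomialFn (k : Fin d) (α : Fin d → ℕ) (g : jointKernel T a) :
    mulCoord a I k (monomialFn a I α g) = monomialFn a I (α + Pi.single k 1) g :=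
  RKHS.ext fun z => by
    rw [mulCoord_apply, monomialFn_apply, monomialFn_apply, monomial_add_single, mul_smul]

lemma monomialFn_sub (α : Fin d → ℕ) (f g : jointKernel T a) :
    monomialFn a I α (f - g) = monomialFn a I α f - monomialFn a I α g :=
  RKHS.ext fun z => by
    rw [RKHS.coe_sub, Pi.sub_apply, monomialFn_apply, monomialFn_apply, monomialFn_apply, smul_sub]

lemma monomialFn_eq_zero {α : Fin d → ℕ} {g : jointKernel T a} (h : monomialFn a I α g = 0) :
    g = 0 := by
  have h1 := inner_monomialFn_depthDiag a I α g g
  rw [h, inner_zero_right] at h1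
  exact inner_self_eq_zero.1 h1.symm

lemma inner_constFn (x : DruryArveson a I) (g : jointKernel T a) :
    ⟪x, constFn a I g⟫_ℂ = ⟪x UnitBall.zero, g⟫_ℂ := RKHS.inner_kerFun _ _ _

lemma norm_constFn (g : jointKernel T a) : ‖constFn a I g‖ = ‖g‖ := by
  have h := inner_constFn a I (constFn a I g) g
  rw [constFn_apply] at h
  rw [norm_eq_sqrt_re_inner (𝕜 := ℂ) (constFn a I g), h, norm_eq_sqrt_re_inner (𝕜 := ℂ) g]

/-- Constants are kernel functions at the centre of the ball, where `z_k h` vanishes. -/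
lemma inner_constFn_mulCoord (g : jointKernel T a) (k : Fin d) (h : DruryArveson a I) :
    ⟪constFn a I g, mulCoord a I k h⟫_ℂ = 0 := by
  refine (RKHS.kerFun_inner _ _ _).trans ?_
  rw [mulCoord_apply, show UnitBall.coord k UnitBall.zero = 0 from rfl, zero_smul,
    inner_zero_right]

/-- The constant functions are the joint kernel of the adjoints of the `ℳ_{z_k}`. -/
lemma eq_constFn_of_inner_mulCoord {x : DruryArveson a I}
    (hx : ∀ k h, ⟪x, mulCoord a I k h⟫_ℂ = 0) : x = constFn a I (x UnitBall.zero) := by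
  -- The difference is orthogonal to constants by the reproducing property at `0`, and to every
  -- other monomial because that lies in the range of some `ℳ_{z_k}`; monomials are total.
  refine sub_eq_zero.1 (eq_zero_of_inner_monomialFn a I fun α => ?_)
  induction α using multiIndex_induction with
  | h0 =>
    intro g
    rw [monomialFn_zero, inner_constFn, RKHS.coe_sub, Pi.sub_apply, constFn_apply, sub_self,
      inner_zero_left]
  | h1 α k _ =>
    intro g
    rw [← mulCoord_monomialFn, inner_sub_left, hx, inner_constFn_mulCoord, sub_zero]

/-- This removes the choice of representatives `Ω_F`: the level space becomes a pure support
condition, which can be compared with joint eigenspaces. -/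
lemma mem_levelSpace_iff {n : Fin d → ℕ} {F : Finset (Fin d)} {x : DruryArveson a I} :
    x ∈ levelSpace a I n F ↔ ∃ g, IsSupportedAt a n F g ∧ constFn a I g = x := by
  classical
  constructor
  · intro hx
    let S : Submodule ℂ (jointKernel T a) :=
      { carrier := {g | ∀ v, ¬ (depth T v = n ∧ v ∈ Phi T F) → g.1 v = 0}
        zero_mem' := fun v _ => rfl
        add_mem' := fun {f g} hf hg v hv => by
          change f.1 v + g.1 v = 0
          rw [hf v hv, hg v hv, add_zero]
        smul_mem' := fun c f hf v hv => by
          change c • f.1 v = 0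
          rw [hf v hv, smul_zero] }
    have hle : levelSpace a I n F ≤ S.map (constFn a I).toLinearMap := by
      refine iSup₂_le fun u hu => Submodule.map_mono fun g hg v hv => ?_
      have hg' : g.1 ∈ solutionSpace T a u F := hg
      refine hg'.1 v fun hvu => hv ?_
      have hd := depth_eq_of_mem_sib T hvu
      rw [mem_Phi_iff, hd, ← mem_Phi_iff]
      exact ⟨hu.2, I.subset_Phi F hu.1⟩
    obtain ⟨g, hg, rfl⟩ := hle hx
    exact ⟨g, fun v hv => by_contra fun h => hv (hg v h), rfl⟩
  · rintro ⟨g, hg, rfl⟩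
    -- The projections onto the `𝓛_{u,F}` sum to the identity; those with the wrong depth or the
    -- wrong `F` annihilate `g`.
    rw [← depthDiag_one a I g]
    simp only [depthDiag, sum_apply, map_sum, Complex.ofReal_one,
      one_smul]
    refine Submodule.sum_mem _ fun F' _ => Submodule.sum_mem _ fun u _ => ?_
    by_cases h : depth T u.1 = n ∧ F' = F
    · obtain ⟨h1, rfl⟩ := h
      exact le_iSup₂ (f := fun u (_ : u ∈ {u | u ∈ I.Ω F' ∧ depth T u = n}) =>
          (solutionSpaceIn T a u F').map (constFn a I).toLinearMap) u.1 ⟨u.2, h1⟩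
        (Submodule.mem_map_of_mem (Submodule.starProjection_apply_mem _ _))
    · have h0 : (solutionSpaceIn T a u.1 F').starProjection g = 0 := by
        refine jointKernel_ext fun v => ?_
        rw [starProjection_apply T a u.1 F' (I.subset_Phi F' u.2)]
        change _ = (0 : ℂ)
        split_ifs with hv
        · by_contra hgv
          obtain ⟨h1, h2⟩ := hg v hgv
          have hd := depth_eq_of_mem_sib T hv
          have hu := I.subset_Phi F' u.2
          rw [mem_Phi_iff] at h2 hu
          rw [← hd] at h hu
          exact h ⟨h1, hu.trans h2.symm⟩
        · rfl
      rw [h0, map_zero]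
      exact Submodule.zero_mem _

/-- Being supported at depth `n` is recast as a joint eigenvector equation, a condition that
transports along intertwining maps. The forward direction is where separation of depths by
coefficients, hence `a * d ≠ 1`, is used. -/
lemma depthDiag_eq_smul_iff [NeZero d] (had : a * d ≠ 1) (n : Fin d → ℕ) (g : jointKernel T a) :
    (∀ α, depthDiag a I (fun m => depthCoeff a m α) g = (depthCoeff a n α : ℂ) • g) ↔
      ∀ v, g.1 v ≠ 0 → depth T v = n := by
  constructor
  · intro h v hv
    refine eq_of_depthCoeff_eq had fun α => ?_
    have h1 : (depthDiag a I (fun m => depthCoeff a m α) g).1 v =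
        (depthCoeff a n α : ℂ) * g.1 v := by rw [h α]; rfl
    rw [depthDiag_apply] at h1
    exact Complex.ofReal_injective (mul_right_cancel₀ hv h1)
  · intro h α
    refine jointKernel_ext fun v => ?_
    rw [depthDiag_apply]
    change _ = _ * g.1 v
    by_cases hv : g.1 v = 0
    · rw [hv, mul_zero, mul_zero]
    · rw [h v hv]

end Module

/-! ### Hilbert module isomorphisms -/

section Iso

variable {d : ℕ} {V₁ V₂ : Fin d → Type*} {T₁ : ∀ i, RootedDirectedTree (V₁ i)}
  {T₂ : ∀ i, RootedDirectedTree (V₂ i)}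
  [∀ i, (T₁ i).LocallyFinite] [∀ i, (T₁ i).FiniteBranchingIndex]
  [∀ i, (T₂ i).LocallyFinite] [∀ i, (T₂ i).FiniteBranchingIndex]
  {a : ℕ} [NeZero a] {I₁ : IndexingSystem T₁} {I₂ : IndexingSystem T₂}
  {U : DruryArveson a I₁ ≃ₗᵢ[ℂ] DruryArveson a I₂}

lemma IsHilbertModuleIso.symm (hU : IsHilbertModuleIso U) : IsHilbertModuleIso U.symm :=
  fun k f => by rw [← U.injective.eq_iff, hU, U.apply_symm_apply, U.apply_symm_apply]

/-- The map `E₁ → E₂` induced by `U` on constant functions. -/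
def constMap (U : DruryArveson a I₁ ≃ₗᵢ[ℂ] DruryArveson a I₂) :
    jointKernel T₁ a →ₗ[ℂ] jointKernel T₂ a where
  toFun g := U (constFn a I₁ g) UnitBall.zero
  map_add' f g := by rw [map_add, map_add, RKHS.coe_add, Pi.add_apply]
  map_smul' c g := by rw [map_smul, map_smul, RKHS.coe_smul, Pi.smul_apply, RingHom.id_apply]

/-- `U` is onto and intertwines, so it maps the range of each `ℳ_{z_k}` onto the corresponding
range; being unitary, it preserves their joint orthogonal complement. -/
lemma map_constFn (hU : IsHilbertModuleIso U) (g : jointKernel T₁ a) :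
    U (constFn a I₁ g) = constFn a I₂ (constMap U g) := by
  refine eq_constFn_of_inner_mulCoord a I₂ fun k h => ?_
  rw [← U.apply_symm_apply h, ← hU, U.inner_map_map, inner_constFn_mulCoord]

lemma map_monomialFn (hU : IsHilbertModuleIso U) (α : Fin d → ℕ) (g : jointKernel T₁ a) :
    U (monomialFn a I₁ α g) = monomialFn a I₂ α (constMap U g) := by
  induction α using multiIndex_induction with
  | h0 => rw [monomialFn_zero, monomialFn_zero, map_constFn hU]
  | h1 α k ih => rw [← mulCoord_monomialFn, ← mulCoord_monomialFn, hU, ih]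

lemma constMap_constMap_symm (hU : IsHilbertModuleIso U) (g : jointKernel T₂ a) :
    constMap U (constMap U.symm g) = g := by
  change U (constFn a I₁ (constMap U.symm g)) UnitBall.zero = g
  rw [← map_constFn hU.symm, U.apply_symm_apply, constFn_apply]

lemma inner_constMap (hU : IsHilbertModuleIso U) (f g : jointKernel T₁ a) :
    ⟪constMap U f, constMap U g⟫_ℂ = ⟪f, g⟫_ℂ := by
  have h := U.inner_map_map (constFn a I₁ f) (constFn a I₁ g)
  rwa [map_constFn hU, map_constFn hU, inner_constFn, inner_constFn, constFn_apply,
    constFn_apply] at h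

lemma constMap_depthDiag (hU : IsHilbertModuleIso U) (α : Fin d → ℕ) (g : jointKernel T₁ a) :
    constMap U (depthDiag a I₁ (fun n => depthCoeff a n α) g) =
      depthDiag a I₂ (fun n => depthCoeff a n α) (constMap U g) := by
  set x := constMap U (depthDiag a I₁ (fun n => depthCoeff a n α) g) with hx
  set y := depthDiag a I₂ (fun n => depthCoeff a n α) (constMap U g) with hy
  -- Both `z^α x` and `z^α y` have inner product `⟪constMap U g, k⟫` with `z^α k`: for `y` by the
  -- monomial formula in the target, for `x` by pulling back along `U` and using the formula in the
  -- source.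
  have h : ∀ k, ⟪monomialFn a I₂ α (x - y), monomialFn a I₂ α k⟫_ℂ = 0 := by
    intro k
    rw [monomialFn_sub, inner_sub_left, hy, inner_monomialFn_depthDiag,
      ← constMap_constMap_symm hU k, inner_constMap hU, hx, ← map_monomialFn hU,
      ← map_monomialFn hU, U.inner_map_map, inner_monomialFn_depthDiag, sub_self]
  exact sub_eq_zero.1 (monomialFn_eq_zero a I₂ (inner_self_eq_zero.1 (h _)))

lemma IsSupportedAt.constMap [NeZero d] (had : a * d ≠ 1) (hU : IsHilbertModuleIso U)
    {n : Fin d → ℕ} {F : Finset (Fin d)} {g : jointKernel T₁ a} (hg : IsSupportedAt a n F g) :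
    IsSupportedAt a n F (constMap U g) := by
  rw [isSupportedAt_iff] at hg ⊢
  refine ⟨?_, fun h => hg.2 fun h0 => h (by rw [h0, map_zero])⟩
  rw [← depthDiag_eq_smul_iff a I₂ had]
  intro α
  rw [← constMap_depthDiag hU, (depthDiag_eq_smul_iff a I₁ had n g).2 hg.1, map_smul]

lemma map_mem_levelSpace [NeZero d] (had : a * d ≠ 1) (hU : IsHilbertModuleIso U)
    {n : Fin d → ℕ} {F : Finset (Fin d)} {x : DruryArveson a I₁} (hx : x ∈ levelSpace a I₁ n F) :
    U x ∈ levelSpace a I₂ n F := by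
  obtain ⟨g, hg, rfl⟩ := (mem_levelSpace_iff a I₁).1 hx
  exact (mem_levelSpace_iff a I₂).2 ⟨_, hg.constMap had hU, (map_constFn hU g).symm⟩

end Iso

/-! ### The indicator function of the root. -/

section Root

variable {d : ℕ} {V : Fin d → Type*} (T : ∀ i, RootedDirectedTree (V i))
  [∀ i, (T i).LocallyFinite]

lemma eRoot_apply (a : ℕ) : (eRoot T a).1 (root T) = 1 := by
  classical
  change eRootFun T (root T) = 1
  rw [eRootFun]
  convert lp.single_apply_self (E := fun _ => ℂ) 2 (root T) (1 : ℂ)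

lemma eRoot_apply_of_ne (a : ℕ) {v : ∀ i, V i} (hv : v ≠ root T) : (eRoot T a).1 v = 0 := by
  classical
  change eRootFun T v = 0
  rw [eRootFun]
  convert lp.single_apply_ne (E := fun _ => ℂ) 2 (root T) (1 : ℂ) hv

lemma norm_eRoot (a : ℕ) : ‖eRoot T a‖ = 1 := by
  classical
  change ‖eRootFun T‖ = 1
  rw [eRootFun, lp.norm_single (by norm_num), norm_one]

lemma isSupportedAt_eRoot [∀ i, (T i).FiniteBranchingIndex] (a : ℕ) :
    IsSupportedAt a 0 ∅ (eRoot T a) := by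
  refine (isSupportedAt_iff a).2 ⟨fun v hv => ?_, fun _ => by simp⟩
  exact (depth_eq_zero_iff T v).2 (by_contra fun h => hv (eRoot_apply_of_ne T a h))

lemma eq_smul_eRoot (a : ℕ) {g : jointKernel T a} (hg : ∀ v, g.1 v ≠ 0 → depth T v = 0) :
    g = g.1 (root T) • eRoot T a := by
  refine jointKernel_ext fun v => ?_
  change _ = g.1 (root T) * (eRoot T a).1 v
  by_cases hv : v = root T
  · rw [hv, eRoot_apply, mul_one]
  · rw [eRoot_apply_of_ne T a hv, mul_zero]
    by_contra h
    exact hv ((depth_eq_zero_iff T v).1 (hg v h))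

end Root

end TreeProduct

end

theorem proposition3p2 {d a : ℕ} [NeZero d] [NeZero a] (had : a * d ≠ 1)
    {V₁ V₂ : Fin d → Type*}
    (T₁ : ∀ i, RootedDirectedTree (V₁ i)) (T₂ : ∀ i, RootedDirectedTree (V₂ i))
    [∀ i, (T₁ i).LocallyFinite] [∀ i, (T₁ i).Leafless] [∀ i, (T₁ i).FiniteBranchingIndex]
    [∀ i, (T₂ i).LocallyFinite] [∀ i, (T₂ i).Leafless] [∀ i, (T₂ i).FiniteBranchingIndex]
    (I₁ : TreeProduct.IndexingSystem T₁) (I₂ : TreeProduct.IndexingSystem T₂)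
    (U : TreeProduct.DruryArveson a I₁ ≃ₗᵢ[ℂ] TreeProduct.DruryArveson a I₂)
    (hU : TreeProduct.IsHilbertModuleIso U) :
    (∀ (α : Fin d → ℕ) (F : Finset (Fin d)),
      (TreeProduct.levelSpace a I₁ α F).map U.toLinearEquiv.toLinearMap =
        TreeProduct.levelSpace a I₂ α F) ∧
    ∃ c : ℂ, ‖c‖ = 1 ∧
      U (TreeProduct.constFn a I₁ (TreeProduct.eRoot T₁ a)) =
        c • TreeProduct.constFn a I₂ (TreeProduct.eRoot T₂ a) := by
  refine ⟨fun α F => le_antisymm ?_ fun x hx => ?_, ?_⟩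
  · rintro _ ⟨x, hx, rfl⟩
    exact TreeProduct.map_mem_levelSpace had hU hx
  -- The reverse inclusion is the forward one for the inverse isomorphism.
  · exact ⟨U.symm x, TreeProduct.map_mem_levelSpace had hU.symm hx, U.apply_symm_apply x⟩
  · have hs := (TreeProduct.isSupportedAt_eRoot T₁ a).constMap had hU
    set g := TreeProduct.constMap U (TreeProduct.eRoot T₁ a) with hg
    have hgc := TreeProduct.eq_smul_eRoot T₂ a fun v hv => (hs v hv).1
    have hUg := TreeProduct.map_constFn hU (TreeProduct.eRoot T₁ a)
    -- The image is supported at depth zero, hence is its value at the root times `e_root`; isometry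
    -- makes that value unimodular.
    refine ⟨g.1 (TreeProduct.root T₂), ?_, ?_⟩
    · have h := congrArg norm hUg
      rw [U.norm_map, TreeProduct.norm_constFn, TreeProduct.norm_constFn,
        TreeProduct.norm_eRoot, ← hg, hgc, norm_smul, TreeProduct.norm_eRoot, mul_one] at h
      exact h.symm
    · rw [hUg, ← hg, ← map_smul, ← hgc]
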